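/- Let $S=\mathbb{C}[x_0,\dots,x_n]=\bigoplus_k S_k$ with its standard grading, let $N>1$, and let $f\in S_N$ be a nonzero homogeneous polynomial of degree $N$ with partial derivatives $f_{x_j}=\partial f/\partial x_j$. Assume that the hypersurface $V: f=0$ in $\mathbb{P}^n=\mathbb{P}^n(\mathbb{C})$ has only isolated singularities, i.e. that its singular locus $V_{sing}=\{p\in V : f_{x_0}(p)=\dots=f_{x_n}(p)=0\}$ is finite (possibly empty). Let $AR(f)\subseteq S^{n+1}$ be the $S$-module of all relations $(a_0,\dots,a_n)$, $a_0f_{x_0}+\dots+a_nf_{x_n}=0$, let $KR(f)\subseteq AR(f)$ be the submodule generated by the Koszul relations $f_{x_j}e_i-f_{x_i}e_j$ (where $e_0,\dots,e_n$ is the standard basis of $S^{n+1}$), and let $ER(f)=AR(f)/KR(f)$ be the graded module of essential relations; $ER(f)_m$ is the image in $ER(f)$ of $AR(f)_m$, the set of the relations with all $a_j\in S_m$. For $p\in V_{sing}$ let $g_p=0$ be a local equation of $V$ at $p$, with $g_p$ in the ring $\mathcal{O}_n$ of germs at the origin of holomorphic functions on $\mathbb{C}^n$, and let $\tau(g_p)=\dim_{\mathbb{C}}\mathcal{O}_n/(J_{g_p}+(g_p))$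 be its Tjurina number, where $J_{g_p}$ is the ideal generated by the first partial derivatives of $g_p$. Let $\tau(V)=\sum_{p\in V_{sing}}\tau(g_p)$. Then $$ER(f)_m=0\quad\text{for any } m\le n(N-2)-\tau(V).$$ -/

import Mathlib

open scoped LinearAlgebra.Projectivization

noncomputable section

namespace JacobianSyzygies

/-! ### Convergent power series: the ring of germs of holomorphic functions at the origin -/

/-- A formal power series over `ℂ` converges (absolutely) on some polydisc around the origin. -/
def IsConvergent {n : ℕ} (φ : MvPowerSeries (Fin n) ℂ) : Prop :=
  ∃ r : ℝ, 0 < r ∧ Summable fun e : Fin n →₀ ℕ => ‖MvPowerSeries.coeff e φ‖ * r ^ e.degree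

/-- A power series that converges with radius `r` converges with every smaller radius. -/
theorem summable_of_le {n : ℕ} {φ : MvPowerSeries (Fin n) ℂ} {r s : ℝ} (hs : 0 < s)
    (hsr : s ≤ r)
    (h : Summable fun e : Fin n →₀ ℕ => ‖MvPowerSeries.coeff e φ‖ * r ^ e.degree) :
    Summable fun e : Fin n →₀ ℕ => ‖MvPowerSeries.coeff e φ‖ * s ^ e.degree := by
  refine Summable.of_nonneg_of_le (fun e => by positivity) (fun e => ?_) h
  gcongr

theorem isConvergent_coe {n : ℕ} (p : MvPolynomial (Fin n) ℂ) :
    IsConvergent (p : MvPowerSeries (Fin n) ℂ) := by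
  refine ⟨1, one_pos, summable_of_ne_finset_zero (s := p.support) fun e he => ?_⟩
  simp [MvPolynomial.coeff_coe, MvPolynomial.notMem_support_iff.mp he]

theorem IsConvergent.add {n : ℕ} {φ ψ : MvPowerSeries (Fin n) ℂ}
    (hφ : IsConvergent φ) (hψ : IsConvergent ψ) : IsConvergent (φ + ψ) := by
  obtain ⟨r, hr, h⟩ := hφ
  obtain ⟨s, hs, h'⟩ := hψ
  have ht : 0 < min r s := lt_min hr hs
  refine ⟨min r s, ht, ?_⟩
  refine Summable.of_nonneg_of_le (fun e => by positivity) (fun e => ?_)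
    ((summable_of_le ht (min_le_left _ _) h).add (summable_of_le ht (min_le_right _ _) h'))
  rw [map_add, ← add_mul]
  gcongr
  exact norm_add_le _ _

theorem norm_coeff_mul_le {n : ℕ} (φ ψ : MvPowerSeries (Fin n) ℂ) {t : ℝ} (ht : 0 < t)
    (e : Fin n →₀ ℕ) :
    ‖MvPowerSeries.coeff e (φ * ψ)‖ * t ^ e.degree ≤
      ∑ q ∈ Finset.HasAntidiagonal.antidiagonal e,
        (‖MvPowerSeries.coeff q.1 φ‖ * t ^ q.1.degree) *
          (‖MvPowerSeries.coeff q.2 ψ‖ * t ^ q.2.degree) := by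
  rw [MvPowerSeries.coeff_mul]
  refine (mul_le_mul_of_nonneg_right (norm_sum_le _ _) (pow_nonneg ht.le _)).trans_eq ?_
  rw [Finset.sum_mul]
  refine Finset.sum_congr rfl fun q hq => ?_
  have hd : e.degree = q.1.degree + q.2.degree := by
    rw [← Finset.HasAntidiagonal.mem_antidiagonal.mp hq, map_add]
  rw [hd, pow_add, norm_mul]
  ring

theorem summable_mul {n : ℕ} {u v : (Fin n →₀ ℕ) → ℝ} (hu : Summable u) (hv : Summable v)
    (hu0 : ∀ e, 0 ≤ u e) (hv0 : ∀ e, 0 ≤ v e) :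
    Summable fun e : Fin n →₀ ℕ =>
      ∑ q ∈ Finset.HasAntidiagonal.antidiagonal e, u q.1 * v q.2 :=
  summable_sum_mul_antidiagonal_of_summable_mul (f := u) (g := v)
    (Summable.mul_of_nonneg hu hv hu0 hv0)

theorem IsConvergent.mul {n : ℕ} {φ ψ : MvPowerSeries (Fin n) ℂ}
    (hφ : IsConvergent φ) (hψ : IsConvergent ψ) : IsConvergent (φ * ψ) := by
  obtain ⟨r, hr, h⟩ := hφ
  obtain ⟨s, hs, h'⟩ := hψ
  obtain ⟨t, ht, htr, hts⟩ : ∃ t : ℝ, 0 < t ∧ t ≤ r ∧ t ≤ s :=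
    ⟨min r s, lt_min hr hs, min_le_left _ _, min_le_right _ _⟩
  have hu := summable_of_le ht htr h
  have hv := summable_of_le ht hts h'
  have key := summable_mul hu hv
    (fun e => mul_nonneg (norm_nonneg _) (pow_nonneg ht.le _))
    (fun e => mul_nonneg (norm_nonneg _) (pow_nonneg ht.le _))
  refine ⟨t, ht, ?_⟩
  refine Summable.of_nonneg_of_le ?_ ?_ key
  · exact fun e => mul_nonneg (norm_nonneg _) (pow_nonneg ht.le _)
  · exact fun e => norm_coeff_mul_le φ ψ ht e

/-- The ring `𝒪ₙ = ℂ{x₁, …, xₙ}` of germs at the origin of holomorphic functions on `ℂⁿ`. -/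
def convergentSeries (n : ℕ) : Subalgebra ℂ (MvPowerSeries (Fin n) ℂ) where
  carrier := {φ | IsConvergent φ}
  mul_mem' := IsConvergent.mul
  add_mem' := IsConvergent.add
  algebraMap_mem' c := by
    have h := isConvergent_coe (MvPolynomial.C c : MvPolynomial (Fin n) ℂ)
    rwa [MvPolynomial.coe_C] at h

/-- The germ at the origin of a polynomial function. -/
def polyGerm {n : ℕ} (g : MvPolynomial (Fin n) ℂ) : convergentSeries n :=
  ⟨(g : MvPowerSeries (Fin n) ℂ), isConvergent_coe g⟩

/-- The Jacobian ideal `J_g ⊆ 𝒪ₙ` of (the germ at the origin of) `g`, generated by the first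
partial derivatives of `g`. -/
def localJacobianIdeal {n : ℕ} (g : MvPolynomial (Fin n) ℂ) : Ideal (convergentSeries n) :=
  Ideal.span (Set.range fun j : Fin n => polyGerm (MvPolynomial.pderiv j g))

/-- The Tjurina algebra `T(g) = 𝒪ₙ / (J_g + (g))`. -/
abbrev TjurinaAlgebra {n : ℕ} (g : MvPolynomial (Fin n) ℂ) : Type :=
  convergentSeries n ⧸ (localJacobianIdeal g ⊔ Ideal.span {polyGerm g})

/-- The Tjurina number `τ(g) = dim_ℂ T(g)` of the germ of `g` at the origin. -/
def localTjurinaNumber {n : ℕ} (g : MvPolynomial (Fin n) ℂ) : ℕ :=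
  Module.finrank ℂ (TjurinaAlgebra g)

/-! ### Projective hypersurfaces and their singularities -/

/-- The singular locus of the hypersurface `V : f = 0` in `ℙⁿ`: the points of `V` at which all
first partial derivatives of `f` vanish (for homogeneous `f` this does not depend on the
representatives of the points). -/
def singularLocus {n : ℕ} (f : MvPolynomial (Fin (n + 1)) ℂ) :
    Set (ℙ ℂ (Fin (n + 1) → ℂ)) :=
  {p | MvPolynomial.eval p.rep f = 0 ∧
    ∀ j, MvPolynomial.eval p.rep (MvPolynomial.pderiv j f) = 0}

/-- The hypersurface `V : f = 0` in `ℙⁿ` has only isolated singularities: its singular locus is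
zero-dimensional (or empty), that is, finite. -/
def HasOnlyIsolatedSingularities {n : ℕ} (f : MvPolynomial (Fin (n + 1)) ℂ) : Prop :=
  (singularLocus f).Finite

theorem exists_rep_ne_zero {n : ℕ} (p : ℙ ℂ (Fin (n + 1) → ℂ)) : ∃ i, p.rep i ≠ 0 :=
  Function.ne_iff.mp p.rep_nonzero

/-- The index `i` of a standard affine chart `x_i ≠ 0` of `ℙⁿ` that contains the point `p`. -/
def chartIndex {n : ℕ} (p : ℙ ℂ (Fin (n + 1) → ℂ)) : Fin (n + 1) :=
  Classical.choose (exists_rep_ne_zero p)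

/-- The coordinates of `p` in the affine chart `x_i ≠ 0`, `i = chartIndex p`. -/
def affineCoord {n : ℕ} (p : ℙ ℂ (Fin (n + 1) → ℂ)) (j : Fin n) : ℂ :=
  p.rep ((chartIndex p).succAbove j) / p.rep (chartIndex p)

/-- A local equation `g_p` of `V : f = 0` at `p`: in `f` put `x_i = 1`, `i = chartIndex p`, and
translate the remaining coordinates so that `p` becomes the origin of `ℂⁿ`. -/
def localEquation {n : ℕ} (f : MvPolynomial (Fin (n + 1)) ℂ) (p : ℙ ℂ (Fin (n + 1) → ℂ)) :
    MvPolynomial (Fin n) ℂ :=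
  MvPolynomial.aeval
    ((chartIndex p).insertNth (α := fun _ => MvPolynomial (Fin n) ℂ) 1
      fun j => MvPolynomial.X j + MvPolynomial.C (affineCoord p j)) f

/-- The Tjurina number `τ(V)`: the sum of the Tjurina numbers of all singularities of `V`. -/
def tjurinaNumber {n : ℕ} (f : MvPolynomial (Fin (n + 1)) ℂ) : ℕ :=
  ∑ᶠ p ∈ singularLocus f, localTjurinaNumber (localEquation f p)

/-! ### Jacobian syzygies -/

/-- `AR(f)`: all relations `a₀ f_{x₀} + ⋯ + aₙ f_{xₙ} = 0`, as tuples of coefficients. -/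
def AR {n : ℕ} (f : MvPolynomial (Fin (n + 1)) ℂ) :
    Submodule (MvPolynomial (Fin (n + 1)) ℂ) (Fin (n + 1) → MvPolynomial (Fin (n + 1)) ℂ) where
  carrier := {a | ∑ j, a j * MvPolynomial.pderiv j f = 0}
  zero_mem' := by simp
  add_mem' {a b} ha hb := by
    simp only [Set.mem_ofPred_eq] at ha hb ⊢
    simp [add_mul, Finset.sum_add_distrib, ha, hb]
  smul_mem' c a ha := by
    simp only [Set.mem_ofPred_eq] at ha ⊢
    simp [mul_assoc, ← Finset.mul_sum, ha]

/-- The Koszul relation `f_{x_j} f_{x_i} + (- f_{x_i}) f_{x_j} = 0`. -/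
def koszulRelation {n : ℕ} (f : MvPolynomial (Fin (n + 1)) ℂ) (i j : Fin (n + 1)) :
    Fin (n + 1) → MvPolynomial (Fin (n + 1)) ℂ :=
  Pi.single i (MvPolynomial.pderiv j f) - Pi.single j (MvPolynomial.pderiv i f)

theorem koszulRelation_mem {n : ℕ} (f : MvPolynomial (Fin (n + 1)) ℂ) (i j : Fin (n + 1)) :
    koszulRelation f i j ∈ AR f := by
  change ∑ k, koszulRelation f i j k * MvPolynomial.pderiv k f = 0
  simp only [koszulRelation, Pi.sub_apply, sub_mul, Finset.sum_sub_distrib, Pi.single_apply,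
    ite_mul, zero_mul, Finset.sum_ite_eq', Finset.mem_univ, if_true]
  ring

/-- `KR(f) ⊆ AR(f)`: the submodule spanned by the Koszul relations. -/
def KR {n : ℕ} (f : MvPolynomial (Fin (n + 1)) ℂ) :
    Submodule (MvPolynomial (Fin (n + 1)) ℂ) (AR f) :=
  Submodule.span _
    (Set.range fun ij : Fin (n + 1) × Fin (n + 1) =>
      (⟨koszulRelation f ij.1 ij.2, koszulRelation_mem f ij.1 ij.2⟩ : AR f))

/-- The module `ER(f) = AR(f) / KR(f)` of essential relations. -/
abbrev ER {n : ℕ} (f : MvPolynomial (Fin (n + 1)) ℂ) : Type :=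
  AR f ⧸ KR f

/-- `AR(f)_m`: the relations all of whose coefficients are homogeneous of degree `m`. -/
def ARDegree {n : ℕ} (f : MvPolynomial (Fin (n + 1)) ℂ) (m : ℕ) : Submodule ℂ (AR f) where
  carrier := {a | ∀ j, (a.1 j).IsHomogeneous m}
  zero_mem' _ := MvPolynomial.isHomogeneous_zero _ _ _
  add_mem' ha hb j := (ha j).add (hb j)
  smul_mem' c _ ha j :=
    (MvPolynomial.homogeneousSubmodule (Fin (n + 1)) ℂ m).smul_mem c (ha j)

/-- The graded piece `ER(f)_m`: the image of `AR(f)_m` in `ER(f)`. -/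
def ERDegree {n : ℕ} (f : MvPolynomial (Fin (n + 1)) ℂ) (m : ℕ) : Submodule ℂ (ER f) :=
  (ARDegree f m).map ((KR f).mkQ.restrictScalars ℂ)

end JacobianSyzygies

end

/-! Let J be the Jacobian ideal and d = N - 1 the degree of the partials. By Euler's formula their
common zeros lie on the finitely many lines over `V_sing`, so n suitable constant combinations g_1,
…, g_n form a regular sequence (`exists_regular_combinations`); an invertible constant matrix
completes them by some g_0. Put I = (g_1, …, g_n). A relation rewritten in these generators has a
coefficient s of g_0 with g_0 s ∈ I, hence J s ⊆ I. Once s ∈ I, Koszul relations reduce it to a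
relation among g_1, …, g_n, which is Koszul by regularity. The heart is therefore
`mem_of_pderiv_mul_mem`: J s ⊆ I and deg s = m ≤ n(d - 1) - τ(V) force s ∈ I.

Suppose s ∉ I. Let ℓ be a linear nonzerodivisor modulo I; dividing s by ℓ modulo I as often as
possible gives b of degree e ≤ m with J b ⊆ I and b ∉ I + (ℓ). The socle of S/(I + (ℓ)) lies in
degree n(d - 1) (`socle_degree`), so for every k ≤ t = n(d - 1) - e there is a form h_k of degree k
with b h_k ∉ I + (ℓ). The t + 1 forms ℓ^(t-k) h_k are linearly independent on the singular scheme: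
if a combination F vanishes there, then ℓ^M F ∈ J for some M (`exists_linear_pow_mul_mem`), so b F ∈
I, and cancelling powers of ℓ kills the coefficients (`eq_zero_of_sum_mem`). The functions on the
singular scheme have dimension τ(V), so t + 1 ≤ τ(V), against t ≥ τ(V). -/

noncomputable section

namespace JacobianSyzygies

open MvPolynomial
open scoped LinearAlgebra.Projectivization

/-! ### Nonzerodivisors modulo an ideal and prime avoidance. -/

section RegularSequences

variable {R : Type*} [CommRing R]

/-- `a` is a nonzerodivisor modulo the ideal `I`. -/
def NzdMod (I : Ideal R) (a : R) : Prop := ∀ s, a * s ∈ I → s ∈ I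

/-- The reverse of the list is a (weakly) regular sequence modulo `I`. -/
def IsRegularMod (I : Ideal R) : List R → Prop
  | [] => True
  | a :: as => IsRegularMod I as ∧ NzdMod (I ⊔ Ideal.ofList as) a

theorem mem_sup_span_singleton {I : Ideal R} {a x : R} :
    x ∈ I ⊔ Ideal.span {a} ↔ ∃ t, x - a * t ∈ I := by
  rw [Submodule.mem_sup]
  constructor
  · rintro ⟨y, hy, z, hz, rfl⟩
    obtain ⟨t, rfl⟩ := Ideal.mem_span_singleton'.mp hz
    exact ⟨t, by rwa [mul_comm a t, add_sub_cancel_right]⟩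
  · rintro ⟨t, ht⟩
    exact ⟨_, ht, a * t, Ideal.mem_span_singleton.mpr (dvd_mul_right _ _), by ring⟩

/-- If `a` is a nonzerodivisor modulo `I` and `b` modulo `I + (a)`, then `a` is a
nonzerodivisor modulo `I + (b)`. -/
theorem NzdMod.swap {I : Ideal R} {a b : R} (ha : NzdMod I a)
    (hab : NzdMod (I ⊔ Ideal.span {a}) b) : NzdMod (I ⊔ Ideal.span {b}) a := by
  intro s hs
  obtain ⟨t, ht⟩ := mem_sup_span_singleton.mp hs
  have h1 : b * t ∈ I ⊔ Ideal.span {a} :=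
    mem_sup_span_singleton.mpr ⟨s, by rw [← neg_mem_iff]; simpa using ht⟩
  obtain ⟨u, hu⟩ := mem_sup_span_singleton.mp (hab t h1)
  refine mem_sup_span_singleton.mpr ⟨u, ha _ ?_⟩
  have := I.add_mem ht (I.mul_mem_left b hu)
  convert this using 1
  ring

theorem NzdMod.pow {I : Ideal R} {a : R} (ha : NzdMod I a) (k : ℕ) : NzdMod I (a ^ k) := by
  induction k with
  | zero => intro s hs; simpa using hs
  | succ k ih =>
    intro s hs
    rw [pow_succ, mul_assoc] at hs
    exact ha _ (ih _ hs)

/-- Prime avoidance: a vector space `F` of zero divisors modulo `I` is annihilated, modulo `I`, by a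
single element, unless `F` lies in one of finitely many prescribed subspaces. -/
theorem exists_nzdMod {K : Type*} [Field K] [Infinite K] [Algebra K R] [IsNoetherianRing R]
    (I : Ideal R) (F : Submodule K R) {ι : Type*} [Finite ι] (U : ι → Submodule K R)
    (hU : ∀ i, ¬ F ≤ U i) (hF : ∀ s, (∀ a ∈ F, a * s ∈ I) → s ∈ I) :
    ∃ a ∈ F, NzdMod I a ∧ ∀ i, a ∉ U i := by
  by_contra! hcon
  have hfin : Finite (associatedPrimes R (R ⧸ I)) := associatedPrimes.finite R (R ⧸ I)
  -- If the claim fails, `F` is covered by its traces on the finitely many associated primes of R/I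
  -- and on the `U i`; over an infinite field one of these subspaces is all of `F`.
  let p : associatedPrimes R (R ⧸ I) ⊕ ι → Submodule K F :=
    Sum.elim (fun P => (P.1.restrictScalars K).comap F.subtype) fun i => (U i).comap F.subtype
  have hcov : ⋃ j, (p j : Set F) = Set.univ := by
    rw [Set.eq_univ_iff_forall]
    rintro ⟨a, ha⟩
    rw [Set.mem_iUnion]
    by_cases hnz : NzdMod I a
    · obtain ⟨i, hi⟩ := hcon a ha hnz
      exact ⟨Sum.inr i, hi⟩
    · simp only [NzdMod, not_forall] at hnz
      obtain ⟨s, hs, hsI⟩ := hnz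
      have : a ∈ ⋃ P ∈ associatedPrimes R (R ⧸ I), (P : Set R) := by
        rw [biUnion_associatedPrimes_eq_zero_divisors]
        refine ⟨Ideal.Quotient.mk I s, fun h => hsI (Ideal.Quotient.eq_zero_iff_mem.mp h), ?_⟩
        rw [← Ideal.Quotient.eq_zero_iff_mem] at hs
        simpa [Algebra.smul_def] using hs
      obtain ⟨P, hP, haP⟩ := Set.mem_iUnion₂.mp this
      exact ⟨Sum.inl ⟨P, hP⟩, haP⟩
  obtain ⟨j, hj⟩ := Subspace.exists_eq_top_of_iUnion_eq_univ hcov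
  rcases j with ⟨P, hP⟩ | i
  · rw [AssociatedPrimes.mem_iff, isAssociatedPrime_iff] at hP
    obtain ⟨hprime, x, hx⟩ := hP
    obtain ⟨s, rfl⟩ := Ideal.Quotient.mk_surjective x
    have hmem : ∀ a, a ∈ P ↔ a * s ∈ I := by
      intro a
      rw [hx, Submodule.mem_colon_singleton, Submodule.mem_bot, ← Ideal.Quotient.eq_zero_iff_mem,
        Algebra.smul_def]
      simp
    have hs : s ∈ I := hF s fun a ha => by
      have : (⟨a, ha⟩ : F) ∈ p (Sum.inl ⟨P, ‹_›⟩) := by rw [hj]; trivial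
      exact (hmem a).mp this
    exact hprime.ne_top ((Ideal.eq_top_iff_one _).mpr ((hmem 1).mpr (by simpa using hs)))
  · refine hU i fun a ha => ?_
    have : (⟨a, ha⟩ : F) ∈ p (Sum.inr i) := by rw [hj]; trivial
    exact this

end RegularSequences

/-! ### Homogeneous ideals and permutation of regular sequences. -/

section Graded

variable {σ K : Type*} [Field K]

theorem homogeneousComponent_mul_left {a : MvPolynomial σ K} {d : ℕ} (ha : a.IsHomogeneous d)
    (s : MvPolynomial σ K) (k : ℕ) :
    homogeneousComponent (k + d) (a * s) = a * homogeneousComponent k s := by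
  classical
  conv_lhs => rw [← sum_homogeneousComponent s]
  rw [Finset.mul_sum, map_sum]
  have h : ∀ i, homogeneousComponent (k + d) (a * homogeneousComponent i s) =
      if i = k then a * homogeneousComponent k s else 0 := by
    intro i
    rw [homogeneousComponent_of_mem (m := k + d) (n := d + i)
      (ha.mul (homogeneousComponent_isHomogeneous i s))]
    by_cases hik : i = k
    · subst hik; simp [add_comm]
    · rw [if_neg (by omega), if_neg hik]
  simp only [h, Finset.sum_ite_eq', Finset.mem_range]
  split_ifs with hk
  · rfl
  · rw [homogeneousComponent_eq_zero k s (by omega), mul_zero]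

theorem homogeneousComponent_mul_left_of_lt {a : MvPolynomial σ K} {d : ℕ} (ha : a.IsHomogeneous d)
    (s : MvPolynomial σ K) {k : ℕ} (hk : k < d) : homogeneousComponent k (a * s) = 0 := by
  classical
  conv_lhs => rw [← sum_homogeneousComponent s]
  rw [Finset.mul_sum, map_sum]
  refine Finset.sum_eq_zero fun i _ => ?_
  rw [homogeneousComponent_of_mem (m := k) (n := d + i)
    (ha.mul (homogeneousComponent_isHomogeneous i s)), if_neg (by omega)]

/-- The ideal `I` is homogeneous. -/
def IsHomogeneousIdeal (I : Ideal (MvPolynomial σ K)) : Prop :=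
  ∀ s ∈ I, ∀ k, homogeneousComponent k s ∈ I

theorem IsHomogeneousIdeal.mem_of_components {I : Ideal (MvPolynomial σ K)} {s : MvPolynomial σ K}
    (h : ∀ k, homogeneousComponent k s ∈ I) : s ∈ I := by
  rw [← sum_homogeneousComponent s]
  exact I.sum_mem fun k _ => h k

section
attribute [local instance] MvPolynomial.gradedAlgebra

theorem isHomogeneousIdeal_span {A : Set (MvPolynomial σ K)}
    (hA : ∀ a ∈ A, ∃ d, a.IsHomogeneous d) : IsHomogeneousIdeal (Ideal.span A) := fun _ hs k =>
  homogeneousComponent_mem_of_mem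
    (Ideal.homogeneous_span (homogeneousSubmodule σ K) A fun a ha => hA a ha) hs k

end

theorem IsHomogeneousIdeal.sup {I J : Ideal (MvPolynomial σ K)} (hI : IsHomogeneousIdeal I)
    (hJ : IsHomogeneousIdeal J) : IsHomogeneousIdeal (I ⊔ J) := by
  intro s hs k
  obtain ⟨y, hy, z, hz, rfl⟩ := Submodule.mem_sup.mp hs
  rw [map_add]
  exact Submodule.add_mem_sup (hI y hy k) (hJ z hz k)

theorem isHomogeneousIdeal_ofList {as : List (MvPolynomial σ K)}
    (has : ∀ a ∈ as, ∃ d, a.IsHomogeneous d) : IsHomogeneousIdeal (Ideal.ofList as) :=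
  isHomogeneousIdeal_span has

/-- Graded division with remainder in an ideal. -/
theorem exists_homogeneous_quotient {I : Ideal (MvPolynomial σ K)} (hI : IsHomogeneousIdeal I)
    {a s : MvPolynomial σ K} {d e : ℕ} (ha : a.IsHomogeneous d) (hs : s.IsHomogeneous e)
    (h : s ∈ I ⊔ Ideal.span {a}) (hsI : s ∉ I) :
    ∃ k t, e = k + d ∧ t.IsHomogeneous k ∧ s - a * t ∈ I := by
  obtain ⟨t, ht⟩ := mem_sup_span_singleton.mp h
  have h2 := hI _ ht e
  rw [map_sub, homogeneousComponent_eq_self hs] at h2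
  by_cases hde : d ≤ e
  · obtain ⟨k, rfl⟩ := Nat.exists_eq_add_of_le' hde
    rw [homogeneousComponent_mul_left ha] at h2
    exact ⟨k, _, rfl, homogeneousComponent_isHomogeneous _ _, h2⟩
  · rw [homogeneousComponent_mul_left_of_lt ha _ (by omega), sub_zero] at h2
    exact absurd h2 hsI

/-- Nonzerodivisors modulo homogeneous ideals can be tested on homogeneous elements. -/
theorem nzdMod_of_homogeneous {I : Ideal (MvPolynomial σ K)} (hI : IsHomogeneousIdeal I)
    {a : MvPolynomial σ K} {d : ℕ} (ha : a.IsHomogeneous d)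
    (h : ∀ (e : ℕ) (s : MvPolynomial σ K), s.IsHomogeneous e → a * s ∈ I → s ∈ I) :
    NzdMod I a := by
  intro s hs
  refine IsHomogeneousIdeal.mem_of_components fun k => h k _
    (homogeneousComponent_isHomogeneous _ _) ?_
  rw [← homogeneousComponent_mul_left ha]
  exact hI _ hs _

/-- Descent on degree: b s ∈ I gives s ≡ a t modulo I, and cancelling a gives b t ∈ I with t of
smaller degree, since deg a > 0. -/
theorem NzdMod.of_sup {I : Ideal (MvPolynomial σ K)} (hI : IsHomogeneousIdeal I)
    {a b : MvPolynomial σ K} {d d' : ℕ} (hd : 0 < d) (ha : a.IsHomogeneous d)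
    (hb : b.IsHomogeneous d') (hnz : NzdMod I a) (hab : NzdMod (I ⊔ Ideal.span {a}) b) :
    NzdMod I b := by
  refine nzdMod_of_homogeneous hI hb fun e => ?_
  induction e using Nat.strong_induction_on with
  | _ e ih =>
    intro s hs hbs
    by_contra hsI
    obtain ⟨k, t, rfl, ht, hst⟩ := exists_homogeneous_quotient hI ha hs
      (hab s (Submodule.mem_sup_left hbs)) hsI
    have h1 : a * (b * t) ∈ I := by
      have := I.sub_mem hbs (I.mul_mem_left b hst)
      convert this using 1
      ring
    have h2 := ih k (by omega) t ht (hnz _ h1)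
    apply hsI
    have := I.add_mem hst (I.mul_mem_left a h2)
    simpa using this

/-- The head of the list is the last element of the sequence. Repeated swaps carry `b` from the end
of the sequence to its beginning. -/
theorem IsRegularMod.sup {I : Ideal (MvPolynomial σ K)} (hI : IsHomogeneousIdeal I)
    {as : List (MvPolynomial σ K)} (has : ∀ a ∈ as, ∃ d, 0 < d ∧ a.IsHomogeneous d)
    {b : MvPolynomial σ K} {d' : ℕ} (hb : b.IsHomogeneous d') (hreg : IsRegularMod I as)
    (hnz : NzdMod (I ⊔ Ideal.ofList as) b) :
    NzdMod I b ∧ IsRegularMod (I ⊔ Ideal.span {b}) as := by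
  induction as with
  | nil => exact ⟨by simpa using hnz, trivial⟩
  | cons a as ih =>
    obtain ⟨d, hd, ha⟩ := has a List.mem_cons_self
    have has' : ∀ a ∈ as, ∃ d, 0 < d ∧ a.IsHomogeneous d := fun x hx =>
      has x (List.mem_cons_of_mem _ hx)
    have heq : I ⊔ Ideal.ofList (a :: as) = (I ⊔ Ideal.ofList as) ⊔ Ideal.span {a} := by
      rw [Ideal.ofList_cons]; ac_rfl
    rw [heq] at hnz
    have hI' : IsHomogeneousIdeal (I ⊔ Ideal.ofList as) :=
      hI.sup (isHomogeneousIdeal_ofList fun x hx => (has' x hx).imp fun _ h => h.2)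
    obtain ⟨h1, h2⟩ := ih has' hreg.1 (NzdMod.of_sup hI' hd ha hb hreg.2 hnz)
    refine ⟨h1, h2, ?_⟩
    have := NzdMod.swap hreg.2 hnz
    rwa [sup_right_comm] at this

end Graded

/-! ### Socle degree of a complete intersection. -/

section Socle

variable {σ K : Type*} [Field K]

theorem mem_span_X_of_isHomogeneous {a : MvPolynomial σ K} {d : ℕ} (hd : 0 < d)
    (ha : a.IsHomogeneous d) : a ∈ Ideal.span (Set.range (X : σ → MvPolynomial σ K)) := by
  rw [← Set.image_univ, mem_ideal_span_X_image]
  intro m hm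
  by_contra! h
  have h0 : m = 0 := Finsupp.ext fun i => h i (Set.mem_univ i)
  have := ha.degree_eq_sum_deg_support hm
  subst h0
  simp at this
  omega

/-- An ideal generated by a space of linear forms is prime. -/
theorem mul_mem_span_linear {W : Submodule K (MvPolynomial σ K)}
    (hW : W ≤ homogeneousSubmodule σ K 1) {a b : MvPolynomial σ K}
    (h : a * b ∈ Ideal.span (W : Set (MvPolynomial σ K))) :
    a ∈ Ideal.span (W : Set (MvPolynomial σ K)) ∨ b ∈ Ideal.span (W : Set (MvPolynomial σ K)) := by
  obtain ⟨f, hf⟩ := W.subtype.exists_leftInverse_of_injective W.ker_subtype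
  have hfW : ∀ w (hw : w ∈ W), f w = ⟨w, hw⟩ := fun w hw => LinearMap.congr_fun hf ⟨w, hw⟩
  -- The linear retraction `f` onto `W` yields the substitution X_i ↦ X_i - f(X_i), whose kernel is
  -- exactly the ideal of `W`; its target is a domain.
  let φ : MvPolynomial σ K →ₐ[K] MvPolynomial σ K :=
    aeval fun i => X i - (f (X i) : MvPolynomial σ K)
  have hφ : ∀ w ∈ homogeneousSubmodule σ K 1, φ w = w - f w := by
    intro w hw
    rw [homogeneousSubmodule_one_eq_span_X] at hw
    induction hw using Submodule.span_induction with
    | mem _ hx => obtain ⟨i, rfl⟩ := hx; simp [φ]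
    | zero => simp
    | add x y _ _ hx hy => rw [map_add, hx, hy, map_add, Submodule.coe_add]; ring
    | smul _ _ _ hx => rw [map_smul, hx, map_smul, Submodule.coe_smul, smul_sub]
  have hker : ∀ s, s ∈ Ideal.span (W : Set (MvPolynomial σ K)) ↔ φ s = 0 := by
    intro s
    constructor
    · intro hs
      have : Ideal.span (W : Set (MvPolynomial σ K)) ≤ RingHom.ker φ := by
        rw [Ideal.span_le]
        intro w hw
        rw [SetLike.mem_coe, RingHom.mem_ker, hφ w (hW hw), hfW w hw, sub_self]
      exact this hs
    · intro hs
      have : s - φ s ∈ Ideal.span (W : Set (MvPolynomial σ K)) := by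
        clear hs
        rw [← Ideal.Quotient.eq_zero_iff_mem, map_sub, sub_eq_zero]
        have : (Ideal.Quotient.mkₐ K (Ideal.span (W : Set (MvPolynomial σ K)))) =
            (Ideal.Quotient.mkₐ K (Ideal.span (W : Set (MvPolynomial σ K)))).comp φ := by
          ext i
          simp only [AlgHom.comp_apply, φ, aeval_X, map_sub, Ideal.Quotient.mkₐ_eq_mk]
          rw [Ideal.Quotient.eq_zero_iff_mem.mpr (Ideal.subset_span (f (X i)).2), sub_zero]
        exact DFunLike.congr_fun this s
      simpa [hs] using this
  rw [hker, map_mul, mul_eq_zero] at h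
  exact h.imp (hker a).mpr (hker b).mpr

theorem ideal_span_submodule_span (A : Set (MvPolynomial σ K)) :
    Ideal.span (Submodule.span K A : Set (MvPolynomial σ K)) = Ideal.span A :=
  le_antisymm
    (Ideal.span_le.mpr fun _ hx => Submodule.span_le_restrictScalars K (MvPolynomial σ K) A hx)
    (Ideal.span_mono Submodule.subset_span)

variable [Fintype σ]

/-- The ideal of the linear forms is prime, so a socle element outside it forces every variable into
it. -/
theorem socle_span_linear {Ws : List (MvPolynomial σ K)} (hWs : ∀ w ∈ Ws, w.IsHomogeneous 1)
    {s : MvPolynomial σ K} {e : ℕ} (hs : s.IsHomogeneous e) (hsW : s ∉ Ideal.ofList Ws)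
    (hX : ∀ i, X i * s ∈ Ideal.ofList Ws) : Fintype.card σ ≤ Ws.length ∧ e = 0 := by
  classical
  set W : Submodule K (MvPolynomial σ K) := Submodule.span K {w | w ∈ Ws} with hWdef
  have hW : W ≤ homogeneousSubmodule σ K 1 := Submodule.span_le.mpr fun w hw => hWs w hw
  have hspan : Ideal.ofList Ws = Ideal.span (W : Set (MvPolynomial σ K)) :=
    (ideal_span_submodule_span _).symm
  rw [hspan] at hsW hX
  have hXW : ∀ i, (X i : MvPolynomial σ K) ∈ Ideal.span (W : Set (MvPolynomial σ K)) := fun i =>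
    (mul_mem_span_linear hW (hX i)).resolve_right hsW
  have hXle : Ideal.span (Set.range (X : σ → MvPolynomial σ K)) ≤
      Ideal.span (W : Set (MvPolynomial σ K)) :=
    Ideal.span_le.mpr (by rintro _ ⟨i, rfl⟩; exact hXW i)
  constructor
  · have hXmem : ∀ i, (X i : MvPolynomial σ K) ∈ W := by
      intro i
      -- The free factor `c` lets the induction pass through multiplication by ring elements; the
      -- degree-one part of w c is c(0) w.
      have hcomp : ∀ x ∈ Ideal.span (W : Set (MvPolynomial σ K)),
          ∀ c, homogeneousComponent 1 (x * c) ∈ W := by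
        intro x hx
        induction hx using Submodule.span_induction with
        | mem _ hx =>
          intro c
          rw [← zero_add 1, homogeneousComponent_mul_left (hW hx), homogeneousComponent_zero,
            mul_comm, ← smul_eq_C_mul]
          exact W.smul_mem _ hx
        | zero => simp
        | add x y _ _ hx hy =>
          intro c
          rw [add_mul, map_add]
          exact W.add_mem (hx c) (hy c)
        | smul c' x _ hx =>
          intro c
          rw [smul_eq_mul, mul_comm c', mul_assoc]
          exact hx _
      have := hcomp _ (hXW i) 1
      rwa [mul_one, homogeneousComponent_eq_self (isHomogeneous_X K i)] at this
    have hli : LinearIndependent K (X : σ → MvPolynomial σ K) := MvPolynomial.linearIndependent_X ..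
    have h1 : Module.finrank K (Submodule.span K (Set.range (X : σ → MvPolynomial σ K))) ≤
        Module.finrank K W := by
      have : Module.Finite K W := by
        rw [hWdef]; exact Module.Finite.span_of_finite K (List.finite_toSet Ws)
      exact Submodule.finrank_mono (Submodule.span_le.mpr (by rintro _ ⟨i, rfl⟩; exact hXmem i))
    rw [finrank_span_eq_card hli] at h1
    refine h1.trans ?_
    have h2 := finrank_span_finset_le_card (R := K) Ws.toFinset
    have : ((Ws.toFinset : Finset _) : Set (MvPolynomial σ K)) = {w | w ∈ Ws} := by ext; simp
    rw [Set.finrank, this] at h2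
    exact h2.trans (List.toFinset_card_le _)
  · by_contra he
    exact hsW (hXle (mem_span_X_of_isHomogeneous (Nat.pos_of_ne_zero he) hs))

/-- The socle of a quotient by a homogeneous regular sequence of linear forms `Ws` and forms `θs` of
degree `d`: it vanishes if the sequence is too short, and otherwise it lives in a single degree. -/
theorem socle_degree [Infinite K] {d : ℕ} (hd : 0 < d) (θs : List (MvPolynomial σ K))
    (hθ : ∀ θ ∈ θs, θ.IsHomogeneous d) (Ws : List (MvPolynomial σ K))
    (hWs : ∀ w ∈ Ws, w.IsHomogeneous 1) (hreg : IsRegularMod (Ideal.ofList Ws) θs)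
    {s : MvPolynomial σ K} {e : ℕ} (hs : s.IsHomogeneous e)
    (hsW : s ∉ Ideal.ofList Ws ⊔ Ideal.ofList θs)
    (hX : ∀ i, X i * s ∈ Ideal.ofList Ws ⊔ Ideal.ofList θs) :
    Fintype.card σ ≤ Ws.length + θs.length ∧ e + θs.length = d * θs.length := by
  induction θs generalizing Ws s e with
  | nil =>
    have := socle_span_linear hWs hs (by simpa using hsW) (by simpa using hX)
    simpa using this
  | cons θ θs ih =>
    have heq : Ideal.ofList Ws ⊔ Ideal.ofList (θ :: θs) =
        (Ideal.ofList Ws ⊔ Ideal.ofList θs) ⊔ Ideal.span {θ} := by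
      rw [Ideal.ofList_cons]; ac_rfl
    rw [heq] at hsW hX
    have hWhom : IsHomogeneousIdeal (Ideal.ofList Ws) :=
      isHomogeneousIdeal_ofList fun w hw => ⟨1, hWs w hw⟩
    have hθhom : IsHomogeneousIdeal (Ideal.ofList θs) :=
      isHomogeneousIdeal_ofList fun w hw => ⟨d, hθ w (List.mem_cons_of_mem _ hw)⟩
    have hIhom := hWhom.sup hθhom
    obtain ⟨hreg', hnz⟩ := hreg
    have hθd := hθ θ List.mem_cons_self
    -- An element killed by all linear forms modulo the ideal is killed by θ, which has positive
    -- degree, hence is zero there: so a linear nonzerodivisor exists.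
    obtain ⟨ℓ, hℓ, hℓnz, -⟩ := exists_nzdMod (Ideal.ofList Ws ⊔ Ideal.ofList θs)
      (homogeneousSubmodule σ K 1) (fun i : Empty => i.elim) (fun i => i.elim) (by
        intro t ht
        apply hnz
        have hle : Ideal.span (Set.range (X : σ → MvPolynomial σ K)) ≤
            (Ideal.ofList Ws ⊔ Ideal.ofList θs).colon {t} := by
          rw [Ideal.span_le]
          rintro _ ⟨i, rfl⟩
          exact Submodule.mem_colon_singleton.mpr (ht _ (isHomogeneous_X K i))
        exact Submodule.mem_colon_singleton.mp (hle (mem_span_X_of_isHomogeneous hd hθd)))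
    generalize hIdef : Ideal.ofList Ws ⊔ Ideal.ofList θs = I at *
    have hℓs : ℓ * s ∈ I ⊔ Ideal.span {θ} := by
      have hle : Ideal.span (Set.range (X : σ → MvPolynomial σ K)) ≤
          (I ⊔ Ideal.span {θ}).colon {s} := by
        rw [Ideal.span_le]
        rintro _ ⟨i, rfl⟩
        exact Submodule.mem_colon_singleton.mpr (hX i)
      exact Submodule.mem_colon_singleton.mp (hle (mem_span_X_of_isHomogeneous one_pos hℓ))
    have hsI : s ∉ I := fun h => hsW (Submodule.mem_sup_left h)
    -- Exchange of θ for ℓ: writing ℓ s ≡ θ t modulo I, the form t is a socle element modulo I +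
    -- (ℓ), and e + 1 = k + d. Each exchange thus contributes d - 1 to the socle degree.
    obtain ⟨k, t, hk, ht, hst⟩ := exists_homogeneous_quotient hIhom hθd
      (IsHomogeneous.mul hℓ hs) hℓs fun h => hsI (hℓnz _ h)
    have heq2 : Ideal.ofList (ℓ :: Ws) ⊔ Ideal.ofList θs = I ⊔ Ideal.span {ℓ} := by
      rw [Ideal.ofList_cons, ← hIdef]; ac_rfl
    have hregℓ := IsRegularMod.sup hWhom
      (fun a ha => ⟨d, hd, hθ a (List.mem_cons_of_mem _ ha)⟩) hℓ hreg' (hIdef ▸ hℓnz)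
    have key := ih (fun a ha => hθ a (List.mem_cons_of_mem _ ha)) (ℓ :: Ws)
      (by
        intro w hw
        rcases List.mem_cons.mp hw with rfl | hw
        · exact hℓ
        · exact hWs w hw)
      (by rw [Ideal.ofList_cons, sup_comm]; exact hregℓ.2) ht
      (by
        rw [heq2]
        intro hmem
        obtain ⟨u, hu⟩ := mem_sup_span_singleton.mp hmem
        refine hsW (mem_sup_span_singleton.mpr ⟨u, hℓnz _ ?_⟩)
        have := I.add_mem hst (I.mul_mem_left θ hu)
        convert this using 1
        ring)
      (by
        intro i
        rw [heq2]
        obtain ⟨u, hu⟩ := mem_sup_span_singleton.mp (hX i)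
        refine mem_sup_span_singleton.mpr ⟨u, hnz _ ?_⟩
        have := I.sub_mem (I.mul_mem_left ℓ hu) (I.mul_mem_left (X i) hst)
        convert this using 1
        ring)
    obtain ⟨k1, k2⟩ := key
    simp only [List.length_cons] at k1 k2 ⊢
    refine ⟨by omega, ?_⟩
    rw [mul_add, mul_one]
    omega

end Socle

/-! ### Koszul relations of regular sequences. -/

section Koszul

variable {R : Type*} [CommRing R]

theorem mem_ofList_ofFn {k : ℕ} {g : Fin k → R} {x : R} :
    x ∈ Ideal.ofList (List.ofFn g) ↔ ∃ b : Fin k → R, ∑ j, b j * g j = x := by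
  have : {r | r ∈ List.ofFn g} = Set.range g := by ext; simp [List.mem_ofFn]
  rw [Ideal.ofList, this, Ideal.mem_span_range_iff_exists_fun]

/-- The relation `a` between the `g i` is a combination of Koszul relations. -/
def IsKoszulRelation {ι : Type*} [Fintype ι] (g a : ι → R) : Prop :=
  ∃ B : Matrix ι ι R, B.transpose = -B ∧ a = B.mulVec g

/-- If a_0 = ∑ b_j g_j, subtracting the Koszul relations b_j (g_j e_0 - g_0 e_j) leaves a relation
among the tail, with coefficients a_j + g_0 b_j. The matrix of the tail is then bordered by b and
-b. -/
theorem isKoszulRelation_of_tail {k : ℕ} {g a : Fin (k + 1) → R}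
    (htail : ∀ a' : Fin k → R, ∑ j, a' j * Fin.tail g j = 0 → IsKoszulRelation (Fin.tail g) a')
    (ha : ∑ j, a j * g j = 0) (ha0 : a 0 ∈ Ideal.ofList (List.ofFn (Fin.tail g))) :
    IsKoszulRelation g a := by
  obtain ⟨b, hb⟩ := mem_ofList_ofFn.mp ha0
  obtain ⟨B, hB, hBa⟩ := htail (fun j => a j.succ + g 0 * b j) (by
    rw [Fin.sum_univ_succ, ← hb, Finset.sum_mul] at ha
    rw [← ha, ← Finset.sum_add_distrib]
    refine Finset.sum_congr rfl fun j _ => ?_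
    simp only [Fin.tail]
    ring)
  refine ⟨Matrix.of (Fin.cons (Fin.cons 0 b) fun i => Fin.cons (-b i) (B i)), ?_, ?_⟩
  · ext i j
    have hij : ∀ i j : Fin k, B j i = -B i j := fun i j => congrFun (congrFun hB i) j
    refine Fin.cases ?_ (fun i => ?_) i <;> refine Fin.cases ?_ (fun j => ?_) j
    · simp
    · simp
    · simp
    · simpa using hij i j
  · ext i
    refine Fin.cases ?_ (fun i => ?_) i
    · simp [Matrix.mulVec, dotProduct, Fin.sum_univ_succ, ← hb, Fin.tail]
    · have := congrFun hBa i
      simp only [Matrix.mulVec, dotProduct, Fin.tail] at this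
      simp only [Matrix.mulVec, dotProduct, Fin.sum_univ_succ, Matrix.of_apply, Fin.cons_succ,
        Fin.cons_zero, ← this]
      ring

theorem isKoszulRelation_of_isRegularMod {k : ℕ} {g : Fin k → R}
    (hg : IsRegularMod ⊥ (List.ofFn g)) (a : Fin k → R) (ha : ∑ j, a j * g j = 0) :
    IsKoszulRelation g a := by
  induction k with
  | zero => exact ⟨0, by simp, Subsingleton.elim _ _⟩
  | succ k ih =>
    rw [List.ofFn_succ] at hg
    refine isKoszulRelation_of_tail (fun a' ha' => ih hg.1 a' ha') ha ?_
    have h1 := hg.2 (a 0) ?_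
    · rwa [bot_sup_eq] at h1
    · rw [bot_sup_eq, mul_comm]
      rw [Fin.sum_univ_succ] at ha
      refine mem_ofList_ofFn.mpr ⟨fun j => -a j.succ, ?_⟩
      simp only [neg_mul, Finset.sum_neg_distrib]
      linear_combination -ha

/-- Koszul relations are preserved by an invertible change of generators. -/
theorem IsKoszulRelation.of_change {ι : Type*} [Fintype ι] [DecidableEq ι] {f a : ι → R}
    {C E : Matrix ι ι R} (hEC : E * C = 1)
    (h : IsKoszulRelation (C.mulVec f) (E.transpose.mulVec a)) : IsKoszulRelation f a := by
  obtain ⟨B, hB, hBa⟩ := h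
  refine ⟨C.transpose * B * C, ?_, ?_⟩
  · rw [Matrix.transpose_mul, Matrix.transpose_mul, hB, Matrix.transpose_transpose]
    simp [Matrix.mul_assoc]
  · have h2 := congrArg C.transpose.mulVec hBa
    rw [Matrix.mulVec_mulVec, ← Matrix.transpose_mul, hEC, Matrix.transpose_one,
      Matrix.one_mulVec] at h2
    rw [h2]
    simp [Matrix.mulVec_mulVec, Matrix.mul_assoc]

end Koszul

/-! ### Regular sequences of general combinations. -/

section Existence

variable {σ K : Type*} [Field K]

/-- Dividing by a linear nonzerodivisor `ℓ` as often as possible. -/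
theorem exists_not_mem_sup {I : Ideal (MvPolynomial σ K)} (hI : IsHomogeneousIdeal I)
    {ℓ : MvPolynomial σ K} (hℓ : ℓ.IsHomogeneous 1) (hnz : NzdMod I ℓ) {e : ℕ}
    {s : MvPolynomial σ K} (hs : s.IsHomogeneous e) (hsI : s ∉ I) :
    ∃ e' s', e' ≤ e ∧ s'.IsHomogeneous e' ∧ s' ∉ I ⊔ Ideal.span {ℓ} ∧
      ∀ a, a * s ∈ I → a * s' ∈ I := by
  induction e generalizing s with
  | zero =>
    refine ⟨0, s, le_rfl, hs, fun h => ?_, fun a ha => ha⟩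
    obtain ⟨k, t, hk, -⟩ := exists_homogeneous_quotient hI hℓ hs h hsI
    omega
  | succ e ih =>
    by_cases h : s ∈ I ⊔ Ideal.span {ℓ}
    · obtain ⟨k, t, hk, ht, hst⟩ := exists_homogeneous_quotient hI hℓ hs h hsI
      obtain rfl : e = k := by omega
      have htI : t ∉ I := fun h => hsI (by simpa using I.add_mem hst (I.mul_mem_left ℓ h))
      obtain ⟨e', s', h1, h2, h3, h4⟩ := ih ht htI
      refine ⟨e', s', by omega, h2, h3, fun a ha => h4 a (hnz _ ?_)⟩
      have := I.sub_mem ha (I.mul_mem_left a hst)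
      convert this using 1
      ring
    · exact ⟨e + 1, s, le_rfl, hs, h, fun a ha => ha⟩

/-- Multiply by variables as long as the product stays outside `I`; fewer than `M` multiplications
are possible. -/
theorem exists_socle_element {I : Ideal (MvPolynomial σ K)} {M : ℕ}
    {s : MvPolynomial σ K} {e : ℕ} (hs : s.IsHomogeneous e) (hsI : s ∉ I)
    (h : ∀ a ∈ Ideal.span (Set.range (X : σ → MvPolynomial σ K)) ^ M, a * s ∈ I) :
    ∃ e' s', s'.IsHomogeneous e' ∧ s' ∉ I ∧ ∀ i, X i * s' ∈ I := by
  induction M generalizing s e with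
  | zero => exact absurd (by simpa using h 1) hsI
  | succ M ih =>
    by_cases hall : ∀ i, X i * s ∈ I
    · exact ⟨e, s, hs, hsI, hall⟩
    · obtain ⟨i, hi⟩ := not_forall.mp hall
      refine ih ((isHomogeneous_X K i).mul hs) hi fun a ha => ?_
      rw [← mul_assoc]
      exact h _ (by rw [pow_succ]; exact Ideal.mul_mem_mul ha (Ideal.subset_span ⟨i, rfl⟩))

/-- A homogeneous component outside the ideal would be a socle element, which `socle_degree`
excludes for fewer forms than variables. -/
theorem mem_of_linear_mul_mem [Fintype σ] [Infinite K] {d : ℕ} (hd : 0 < d)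
    {θs : List (MvPolynomial σ K)} (hθ : ∀ θ ∈ θs, θ.IsHomogeneous d)
    (hreg : IsRegularMod ⊥ θs) (hlen : θs.length < Fintype.card σ) (s : MvPolynomial σ K)
    (hs : ∀ ℓ ∈ homogeneousSubmodule σ K 1, ℓ * s ∈ Ideal.ofList θs) : s ∈ Ideal.ofList θs := by
  refine IsHomogeneousIdeal.mem_of_components fun k => ?_
  by_contra hk
  have hI : IsHomogeneousIdeal (Ideal.ofList θs) := isHomogeneousIdeal_ofList fun θ h => ⟨d, hθ θ h⟩
  have := socle_degree hd θs hθ [] (by simp) (by simpa using hreg)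
    (homogeneousComponent_isHomogeneous k s) (by simpa using hk) (by
      intro i
      rw [Ideal.ofList_nil, bot_sup_eq, ← homogeneousComponent_mul_left (isHomogeneous_X K i)]
      exact hI _ (hs _ (isHomogeneous_X K i)) _)
  simp at this
  omega

/-- A linear form that is a nonzerodivisor modulo `I` and avoids finitely many points. -/
theorem exists_linear_nzdMod [Finite σ] [Infinite K] {I : Ideal (MvPolynomial σ K)}
    (hI : ∀ s, (∀ ℓ ∈ homogeneousSubmodule σ K 1, ℓ * s ∈ I) → s ∈ I)
    {κ : Type*} [Finite κ] {z : κ → σ → K} (hz : ∀ k, z k ≠ 0) :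
    ∃ ℓ : MvPolynomial σ K, ℓ.IsHomogeneous 1 ∧ NzdMod I ℓ ∧ ∀ k, eval (z k) ℓ ≠ 0 := by
  obtain ⟨ℓ, h1, h2, h3⟩ := exists_nzdMod I (homogeneousSubmodule σ K 1)
    (fun k => LinearMap.ker (aeval (R := K) (z k)).toLinearMap) (by
      intro k hk
      obtain ⟨i, hi⟩ := Function.ne_iff.mp (hz k)
      have := hk (isHomogeneous_X K i)
      rw [LinearMap.mem_ker] at this
      simp at this
      exact hi this) hI
  refine ⟨ℓ, h1, h2, fun k hk => h3 k ?_⟩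
  rw [LinearMap.mem_ker]
  simpa [aeval_eq_eval] using hk

/-- The common zeros of the `φ i` lie on the lines spanned by the `z k`. -/
def ZerosOnLines {ι κ : Type*} (φ : ι → MvPolynomial σ K) (z : κ → σ → K) : Prop :=
  ∀ v, (∀ i, eval v (φ i) = 0) → v = 0 ∨ ∃ (k : κ) (c : K), v = c • z k

theorem eval_smul_of_isHomogeneous {a : MvPolynomial σ K} {d : ℕ} (ha : a.IsHomogeneous d) (c : K)
    (v : σ → K) : eval (c • v) a = c ^ d * eval v a := by
  simp only [eval_eq, Finset.mul_sum]
  refine Finset.sum_congr rfl fun m hm => ?_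
  rw [ha.degree_eq_sum_deg_support hm, ← Finset.prod_pow_eq_pow_sum]
  simp only [Pi.smul_apply, smul_eq_mul, mul_pow, Finset.prod_mul_distrib]
  ring

/-- The origin is the only possible common zero of the `φ i` and `ℓ`, so the Nullstellensatz
applies. -/
theorem exists_pow_le_sup [Finite σ] [IsAlgClosed K] {ι κ : Type*} {φ : ι → MvPolynomial σ K}
    {z : κ → σ → K} (hφ : ZerosOnLines φ z) {ℓ : MvPolynomial σ K} (hℓ : ℓ.IsHomogeneous 1)
    (hℓz : ∀ k, eval (z k) ℓ ≠ 0) :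
    ∃ M, Ideal.span (Set.range (X : σ → MvPolynomial σ K)) ^ M ≤
      Ideal.span (Set.range φ) ⊔ Ideal.span {ℓ} := by
  refine Ideal.exists_pow_le_of_le_radical_of_fg ?_ (IsNoetherian.noetherian _)
  rw [← vanishingIdeal_zeroLocus_eq_radical (K := K), Ideal.span_le]
  rintro _ ⟨i, rfl⟩ v hv
  simp only [mem_zeroLocus_iff, aeval_eq_eval] at hv
  have h0 : v = 0 := by
    rcases hφ v fun i => by
      simpa using hv _ (Submodule.mem_sup_left (Ideal.subset_span ⟨i, rfl⟩)) with h | ⟨k, c, rfl⟩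
    · exact h
    · have := hv ℓ (Submodule.mem_sup_right (Ideal.mem_span_singleton_self ℓ))
      simp only [eval_smul_of_isHomogeneous hℓ, pow_one, mul_eq_zero, hℓz k, or_false] at this
      rw [this, zero_smul]
  simp [h0]

theorem ofList_ne_top {d : ℕ} (hd : 0 < d) {θs : List (MvPolynomial σ K)}
    (hθ : ∀ θ ∈ θs, θ.IsHomogeneous d) : (1 : MvPolynomial σ K) ∉ Ideal.ofList θs := by
  intro h
  have hle : Ideal.ofList θs ≤ RingHom.ker (constantCoeff (σ := σ) (R := K)) :=
    Ideal.span_le.mpr fun θ h => by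
      rw [SetLike.mem_coe, RingHom.mem_ker, constantCoeff_eq]
      exact (hθ θ h).coeff_eq_zero (by simpa using hd.ne)
  simpa using hle h

/-- Otherwise some form s ∉ I = (θs) has φ_i s ∈ I for all i. Removing factors ℓ gives t ∉ I + (ℓ)
with the same property; since (φ) + (ℓ) contains a power of the irrelevant ideal, a multiple of t is
a socle element modulo I + (ℓ). That regular sequence is still shorter than the number of variables,
contradicting `socle_degree`. -/
theorem exists_combination_nzdMod [Fintype σ] [IsAlgClosed K] {ι κ : Type*} [Finite κ]
    {φ : ι → MvPolynomial σ K} {z : κ → σ → K} (hz : ∀ k, z k ≠ 0) (hφ : ZerosOnLines φ z)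
    {d : ℕ} (hd : 0 < d) (hφd : ∀ i, (φ i).IsHomogeneous d)
    {θs : List (MvPolynomial σ K)} (hθ : ∀ θ ∈ θs, θ.IsHomogeneous d)
    (hreg : IsRegularMod ⊥ θs) (hlen : θs.length + 1 < Fintype.card σ) :
    ∃ θ ∈ Submodule.span K (Set.range φ), NzdMod (Ideal.ofList θs) θ := by
  have : Infinite K := IsAlgClosed.instInfinite
  have hI : IsHomogeneousIdeal (Ideal.ofList θs) := isHomogeneousIdeal_ofList fun θ h => ⟨d, hθ θ h⟩
  obtain ⟨θ, h1, h2, -⟩ := exists_nzdMod (Ideal.ofList θs) (Submodule.span K (Set.range φ))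
    (fun i : Empty => i.elim) (fun i => i.elim) (by
      intro s hs
      refine IsHomogeneousIdeal.mem_of_components fun k => ?_
      by_contra hk
      obtain ⟨ℓ, hℓ, hℓnz, hℓz⟩ := exists_linear_nzdMod
        (mem_of_linear_mul_mem hd hθ hreg (by omega)) hz
      obtain ⟨e, t, -, ht, htI, hts⟩ := exists_not_mem_sup hI hℓ hℓnz
        (homogeneousComponent_isHomogeneous k s) hk
      obtain ⟨M, hM⟩ := exists_pow_le_sup hφ hℓ hℓz
      obtain ⟨e', u, hu, huI, hX⟩ := exists_socle_element (M := M) ht htI (by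
        intro a ha
        have hle : Ideal.span (Set.range φ) ⊔ Ideal.span {ℓ} ≤
            (Ideal.ofList θs ⊔ Ideal.span {ℓ}).colon {t} := by
          refine sup_le (Ideal.span_le.mpr ?_) (Ideal.span_le.mpr ?_)
          · rintro _ ⟨i, rfl⟩
            refine Submodule.mem_colon_singleton.mpr (Submodule.mem_sup_left (hts _ ?_))
            rw [← homogeneousComponent_mul_left (hφd i)]
            exact hI _ (hs _ (Submodule.subset_span ⟨i, rfl⟩)) _
          · rintro _ rfl
            exact Submodule.mem_colon_singleton.mpr (Submodule.mem_sup_right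
              (Ideal.mul_mem_right _ _ (Ideal.mem_span_singleton_self _)))
        exact Submodule.mem_colon_singleton.mp (hle (hM ha)))
      have hbot : IsHomogeneousIdeal (⊥ : Ideal (MvPolynomial σ K)) := by
        intro s hs k
        rw [Ideal.mem_bot] at hs
        simp [hs]
      have hreg2 := IsRegularMod.sup hbot (fun a ha => ⟨d, hd, hθ a ha⟩) hℓ hreg
        (by rwa [bot_sup_eq])
      have hsing : Ideal.ofList [ℓ] = Ideal.span {ℓ} := Ideal.ofList_singleton ℓ
      have := socle_degree hd θs hθ [ℓ] (by simpa using hℓ)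
        (by rw [hsing]; simpa using hreg2.2) hu (by rwa [hsing, sup_comm])
        (by rw [hsing, sup_comm]; exact hX)
      simp at this
      omega)
  exact ⟨θ, h1, h2⟩

/-- Generic combinations of the `φ i` form a regular sequence. -/
theorem exists_regular_combinations [Fintype σ] [IsAlgClosed K] {ι κ : Type*} [Fintype ι] [Finite κ]
    {φ : ι → MvPolynomial σ K} {z : κ → σ → K} (hz : ∀ k, z k ≠ 0) (hφ : ZerosOnLines φ z)
    {d : ℕ} (hd : 0 < d) (hφd : ∀ i, (φ i).IsHomogeneous d) (k : ℕ) (hk : k < Fintype.card σ) :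
    ∃ c : Fin k → ι → K, LinearIndependent K c ∧
      IsRegularMod ⊥ (List.ofFn fun j => Fintype.linearCombination K φ (c j)) := by
  have hhom : ∀ x, (Fintype.linearCombination K φ x).IsHomogeneous d := fun x =>
    (homogeneousSubmodule σ K d).sum_mem fun i _ =>
      (homogeneousSubmodule σ K d).smul_mem _ (hφd i)
  induction k with
  | zero => exact ⟨Fin.elim0, linearIndependent_empty_type, trivial⟩
  | succ k ih =>
    obtain ⟨c, hc, hreg⟩ := ih (by omega)
    have hθ : ∀ θ ∈ List.ofFn fun j => Fintype.linearCombination K φ (c j), θ.IsHomogeneous d := by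
      intro θ h
      obtain ⟨j, rfl⟩ := List.mem_ofFn.mp h
      exact hhom _
    obtain ⟨θ, hθF, hnz⟩ := exists_combination_nzdMod hz hφ hd hφd hθ hreg (by simpa using hk)
    rw [← Fintype.range_linearCombination] at hθF
    obtain ⟨x, rfl⟩ := hθF
    refine ⟨Fin.cons x c, linearIndependent_finCons.mpr ⟨hc, fun hx => ?_⟩, ?_⟩
    -- If x depended on the earlier vectors, the new form would lie in the ideal of the earlier
    -- ones, and cancelling it would put 1 there.
    · refine ofList_ne_top hd hθ (hnz 1 ?_)
      rw [mul_one]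
      clear hnz
      induction hx using Submodule.span_induction with
      | mem y hy =>
        obtain ⟨j, rfl⟩ := hy
        exact Ideal.subset_span (List.mem_ofFn.mpr ⟨j, rfl⟩)
      | zero => simp
      | add y z _ _ hy hz => rw [map_add]; exact Ideal.add_mem _ hy hz
      | smul c y _ hy => rw [map_smul, smul_eq_C_mul]; exact Ideal.mul_mem_left _ _ hy
    · rw [List.ofFn_succ]
      exact ⟨hreg, by simpa using hnz⟩

end Existence

/-! ### Division of convergent series; descent from germs to polynomials. -/

section Convergent

variable {n : ℕ}

/-- The germ at the origin of a polynomial function, as a homomorphism. -/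
def polyGermHom (n : ℕ) : MvPolynomial (Fin n) ℂ →ₐ[ℂ] convergentSeries n :=
  (coeToMvPowerSeries.algHom (R := ℂ) ℂ).codRestrict (convergentSeries n) fun p => by
    change IsConvergent (coeToMvPowerSeries.algHom ℂ p)
    simpa [coeToMvPowerSeries.algHom_apply] using isConvergent_coe p

theorem coe_polyGermHom (p : MvPolynomial (Fin n) ℂ) :
    (polyGermHom n p : MvPowerSeries (Fin n) ℂ) = p := by
  change coeToMvPowerSeries.algHom (R := ℂ) ℂ p = p
  simp [coeToMvPowerSeries.algHom_apply]

theorem polyGermHom_apply (p : MvPolynomial (Fin n) ℂ) : polyGermHom n p = polyGerm p :=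
  Subtype.ext (coe_polyGermHom p)

theorem coeff_X_pow_mul' (j : Fin n) (a : ℕ) (ψ : MvPowerSeries (Fin n) ℂ) (e : Fin n →₀ ℕ) :
    MvPowerSeries.coeff e ((MvPowerSeries.X j) ^ a * ψ) =
      if a ≤ e j then MvPowerSeries.coeff (e - Finsupp.single j a) ψ else 0 := by
  classical
  rw [MvPowerSeries.X_pow_eq, MvPowerSeries.coeff_monomial_mul]
  simp only [Finsupp.single_le_iff, one_mul]

theorem isConvergent_shift {φ ψ : MvPowerSeries (Fin n) ℂ} (hφ : IsConvergent φ)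
    (m : Fin n →₀ ℕ)
    (h : ∀ e, ‖MvPowerSeries.coeff e ψ‖ ≤ ‖MvPowerSeries.coeff (e + m) φ‖) : IsConvergent ψ := by
  obtain ⟨r, hr, hs⟩ := hφ
  refine ⟨r, hr, ?_⟩
  have h1 := (hs.comp_injective (add_left_injective m)).mul_left ((r ^ m.degree)⁻¹)
  refine Summable.of_nonneg_of_le (fun e => by positivity) (fun e => ?_) h1
  simp only [Function.comp_apply, map_add, pow_add]
  rw [mul_comm (r ^ e.degree), ← mul_assoc, ← mul_assoc, mul_comm _ ‖_‖, mul_assoc ‖_‖,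
    inv_mul_cancel₀ (by positivity), mul_one]
  gcongr
  exact h e

/-- Division of a convergent series by the powers `X j ^ (b + 1)`; the remainder is a polynomial of
degree at most `b` in every variable. -/
theorem exists_division (b : ℕ) (φ : convergentSeries n) :
    ∃ ψ : Fin n → convergentSeries n,
      φ = polyGermHom n (MvPowerSeries.trunc' ℂ (Finsupp.equivFunOnFinite.symm fun _ => b) φ.1) +
        ∑ j, polyGermHom n (X j) ^ (b + 1) * ψ j := by
  classical
  set E : Fin n →₀ ℕ := Finsupp.equivFunOnFinite.symm fun _ => b with hE
  have hex : ∀ e : Fin n →₀ ℕ, ¬ e ≤ E → ∃ j, b + 1 ≤ e j := by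
    intro e he
    rw [Finsupp.le_def, not_forall] at he
    obtain ⟨j, hj⟩ := he
    refine ⟨j, ?_⟩
    simp [hE] at hj
    omega
  rcases isEmpty_or_nonempty (Fin n) with hempty | hne
  · refine ⟨fun j => isEmptyElim j, Subtype.ext (MvPowerSeries.ext fun e => ?_)⟩
    simp [coe_polyGermHom, MvPowerSeries.coeff_trunc']
  -- `J` assigns each monomial outside the box to one variable with large exponent, so each quotient
  -- is a shifted part of φ and converges.
  choose! J hJ using hex
  let ψ : Fin n → MvPowerSeries (Fin n) ℂ := fun j e =>
    if ¬ e + Finsupp.single j (b + 1) ≤ E ∧ J (e + Finsupp.single j (b + 1)) = j then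
      MvPowerSeries.coeff (e + Finsupp.single j (b + 1)) φ.1 else 0
  have hψc : ∀ j e, MvPowerSeries.coeff e (ψ j) =
    if ¬ e + Finsupp.single j (b + 1) ≤ E ∧ J (e + Finsupp.single j (b + 1)) = j then
      MvPowerSeries.coeff (e + Finsupp.single j (b + 1)) φ.1 else 0 := fun _ _ => rfl
  have hψ : ∀ j, IsConvergent (ψ j) := fun j =>
    isConvergent_shift φ.2 (Finsupp.single j (b + 1)) fun e => by
      rw [hψc]
      split_ifs
      · exact le_rfl
      · simp
  refine ⟨fun j => ⟨ψ j, hψ j⟩, Subtype.ext (MvPowerSeries.ext fun e => ?_)⟩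
  simp only [AddMemClass.coe_add, AddSubmonoidClass.coe_finsetSum, MulMemClass.coe_mul,
    SubmonoidClass.coe_pow, coe_polyGermHom, map_add, map_sum, coeff_coe, coe_X,
    coeff_X_pow_mul', MvPowerSeries.coeff_trunc', hψc]
  have hterm : ∀ j, (if b + 1 ≤ e j then
      (if ¬ e - Finsupp.single j (b + 1) + Finsupp.single j (b + 1) ≤ E ∧
        J (e - Finsupp.single j (b + 1) + Finsupp.single j (b + 1)) = j then
        MvPowerSeries.coeff (e - Finsupp.single j (b + 1) + Finsupp.single j (b + 1)) φ.1
        else 0) else 0) =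
      if J e = j then (if e ≤ E then 0 else MvPowerSeries.coeff e φ.1) else 0 := by
    intro j
    by_cases hj : b + 1 ≤ e j
    · rw [if_pos hj, tsub_add_cancel_of_le (Finsupp.single_le_iff.mpr hj)]
      by_cases h1 : e ≤ E <;> by_cases h2 : J e = j <;> simp [h1, h2]
    · rw [if_neg hj]
      by_cases h2 : J e = j
      · by_cases h1 : e ≤ E
        · simp [h1]
        · exact absurd (h2 ▸ hJ e h1) hj
      · simp [h2]
  simp only [hterm, Finset.sum_ite_eq, Finset.mem_univ, if_true]
  split_ifs <;> simp

theorem mem_span_X_pow_of_germ {a : ℕ} {F : MvPolynomial (Fin n) ℂ}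
    {ψ : Fin n → convergentSeries n}
    (h : polyGermHom n F = ∑ j, polyGermHom n (X j) ^ a * ψ j) :
    F ∈ Ideal.span (Set.range fun j : Fin n => (X j : MvPolynomial (Fin n) ℂ) ^ a) := by
  have hset : (Set.range fun j : Fin n => (X j : MvPolynomial (Fin n) ℂ) ^ a) =
      (fun s => monomial s (1 : ℂ)) '' Set.range fun j => Finsupp.single j a := by
    rw [← Set.range_comp]
    congr 1
    funext j
    simp [X_pow_eq_monomial]
  rw [hset, mem_ideal_span_monomial_image]
  intro m hm
  by_contra! hcon
  rw [mem_support_iff] at hm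
  apply hm
  have h2 := congrArg (fun x : convergentSeries n => MvPowerSeries.coeff m x.1) h
  simp only [AddSubmonoidClass.coe_finsetSum, MulMemClass.coe_mul,
    SubmonoidClass.coe_pow, coe_polyGermHom, map_sum, coeff_coe, coe_X, coeff_X_pow_mul'] at h2
  rw [h2]
  refine Finset.sum_eq_zero fun j _ => if_neg fun hj => ?_
  exact hcon _ ⟨j, rfl⟩ (Finsupp.single_le_iff.mpr hj)

/-- An ideal of polynomials that contains `u X_j ^ (b + 1)` for all `j` can be recovered, up to
multiplication by `u`, from the ideal of germs that it generates. -/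
theorem mul_mem_of_germ_mem {I : Ideal (MvPolynomial (Fin n) ℂ)} {u : MvPolynomial (Fin n) ℂ}
    {b : ℕ} (hu : ∀ j, u * X j ^ (b + 1) ∈ I) {h : MvPolynomial (Fin n) ℂ}
    (hh : polyGermHom n h ∈ I.map (polyGermHom n)) : u * h ∈ I := by
  -- Dividing the coefficients shows that a germ of the extended ideal is an element of `I` up to
  -- the powers `X j ^ (b + 1)`, which `u` multiplies into `I`.
  have key : ∀ x ∈ I.map (polyGermHom n), ∃ c ∈ I, ∃ ψ : Fin n → convergentSeries n,
      x = polyGermHom n c + ∑ j, polyGermHom n (X j) ^ (b + 1) * ψ j := by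
    intro x hx
    induction hx using Submodule.span_induction with
    | mem x hx =>
      obtain ⟨c, hc, rfl⟩ := hx
      exact ⟨c, hc, 0, by simp⟩
    | zero => exact ⟨0, I.zero_mem, 0, by simp⟩
    | add x y _ _ hx hy =>
      obtain ⟨c, hc, ψ, rfl⟩ := hx
      obtain ⟨c', hc', ψ', rfl⟩ := hy
      refine ⟨c + c', I.add_mem hc hc', ψ + ψ', ?_⟩
      simp only [map_add, Pi.add_apply, mul_add, Finset.sum_add_distrib]
      ring
    | smul φ x _ hx =>
      obtain ⟨c, hc, ψ, rfl⟩ := hx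
      obtain ⟨ψ', hψ'⟩ := exists_division b φ
      generalize (MvPowerSeries.trunc' ℂ (Finsupp.equivFunOnFinite.symm fun _ => b)) φ.1 = T at hψ'
      refine ⟨T * c, I.mul_mem_left _ hc, fun j => ψ' j * polyGermHom n c + φ * ψ j, ?_⟩
      rw [map_mul, smul_eq_mul, mul_add]
      nth_rewrite 1 [hψ']
      simp only [mul_add, Finset.sum_add_distrib, add_mul, Finset.sum_mul, Finset.mul_sum]
      rw [add_assoc]
      congr 2
      · exact Finset.sum_congr rfl fun j _ => by ring
      · exact Finset.sum_congr rfl fun j _ => by ring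
  obtain ⟨c, hc, ψ, hψ⟩ := key _ hh
  have h1 : h - c ∈ Ideal.span (Set.range fun j : Fin n => (X j : MvPolynomial (Fin n) ℂ) ^ (b + 1)) :=
    mem_span_X_pow_of_germ (ψ := ψ) (by rw [map_sub, hψ]; ring)
  have h2 : u * (h - c) ∈ I := by
    have hle : Ideal.span (Set.range fun j : Fin n => (X j : MvPolynomial (Fin n) ℂ) ^ (b + 1)) ≤
        I.colon {u} := Ideal.span_le.mpr (by
      rintro _ ⟨j, rfl⟩
      refine Submodule.mem_colon_singleton.mpr ?_
      rw [smul_eq_mul, mul_comm]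
      exact hu j)
    have := Submodule.mem_colon_singleton.mp (hle h1)
    rwa [smul_eq_mul, mul_comm] at this
  have := I.add_mem h2 (I.mul_mem_left u hc)
  rwa [← mul_add, sub_add_cancel] at this

/-- As `u` is invertible at the origin, the extended ideal contains the powers `X j ^ (b + 1)`; the
monomials with exponents at most `b` span the quotient. -/
theorem finite_quotient_map {I : Ideal (MvPolynomial (Fin n) ℂ)} {u : MvPolynomial (Fin n) ℂ}
    {b : ℕ} (hu : ∀ j, u * X j ^ (b + 1) ∈ I) (hunit : IsUnit (polyGermHom n u)) :
    Module.Finite ℂ (convergentSeries n ⧸ I.map (polyGermHom n)) := by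
  classical
  set E : Fin n →₀ ℕ := Finsupp.equivFunOnFinite.symm fun _ => b with hE
  refine Module.Finite.of_surjective (Fintype.linearCombination ℂ fun e : Finset.Iic E =>
    Ideal.Quotient.mkₐ ℂ (I.map (polyGermHom n)) (polyGermHom n (monomial e.1 1))) fun x => ?_
  obtain ⟨φ, rfl⟩ := Ideal.Quotient.mk_surjective x
  obtain ⟨ψ, hψ⟩ := exists_division b φ
  have hX : ∀ j, polyGermHom n (X j) ^ (b + 1) ∈ I.map (polyGermHom n) := fun j => by
    have := Ideal.mem_map_of_mem (polyGermHom n) (hu j)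
    rw [map_mul, map_pow] at this
    exact (Ideal.unit_mul_mem_iff_mem _ hunit).mp this
  rw [← hE] at hψ
  refine ⟨fun e => MvPowerSeries.coeff e.1 φ.1, ?_⟩
  have h1 : MvPowerSeries.trunc' ℂ E φ.1 = ∑ e : Finset.Iic E,
      MvPowerSeries.coeff e.1 φ.1 • monomial e.1 (1 : ℂ) := by
    ext m
    rw [MvPowerSeries.coeff_trunc', coeff_sum]
    simp only [coeff_smul, coeff_monomial, smul_eq_mul, mul_ite, mul_one, mul_zero]
    rw [Finset.sum_coe_sort (Finset.Iic E)
      (fun e => if e = m then MvPowerSeries.coeff e φ.1 else 0), Finset.sum_ite_eq']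
    simp
  have h2 : Ideal.Quotient.mkₐ ℂ (I.map (polyGermHom n))
      (polyGermHom n (MvPowerSeries.trunc' ℂ E φ.1)) = Ideal.Quotient.mk _ φ := by
    rw [Ideal.Quotient.mkₐ_eq_mk, Ideal.Quotient.eq, ← neg_mem_iff, neg_sub]
    nth_rewrite 1 [hψ]
    rw [add_sub_cancel_left]
    exact Ideal.sum_mem _ fun j _ => Ideal.mul_mem_right _ _ (hX j)
  rw [Fintype.linearCombination_apply, ← h2, h1, map_sum, map_sum]
  simp only [map_smul]

/-- The inverse is the geometric series -∑ x^k / c^(k+1); at radius |c|/2 its ratio is 1/2. -/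
theorem isUnit_polyGermHom_X_sub_C (j : Fin n) {c : ℂ} (hc : c ≠ 0) :
    IsUnit (polyGermHom n (X j - C c)) := by
  classical
  let ψ : MvPowerSeries (Fin n) ℂ := fun e =>
    if e = Finsupp.single j (e j) then -(c⁻¹) ^ (e j + 1) else 0
  have hψc : ∀ e, MvPowerSeries.coeff e ψ =
    if e = Finsupp.single j (e j) then -(c⁻¹) ^ (e j + 1) else 0 := fun _ => rfl
  have hc0 : 0 < ‖c‖ := norm_pos_iff.mpr hc
  have hψ : IsConvergent ψ := by
    refine ⟨‖c‖ / 2, by positivity, ?_⟩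
    rw [← (Finsupp.single_injective j).summable_iff]
    · have : Summable fun k : ℕ => ‖c‖⁻¹ * (1 / 2 : ℝ) ^ k := summable_geometric_two.mul_left _
      refine this.congr fun k => ?_
      simp only [Function.comp_apply, hψc, Finsupp.single_eq_same, if_true, norm_neg, norm_pow,
        norm_inv, Finsupp.degree_single, div_pow]
      rw [pow_succ, one_pow, inv_pow]
      field_simp
    · intro e he
      rw [hψc, if_neg fun h => he ⟨_, h.symm⟩]
      simp
  refine IsUnit.of_mul_eq_one ⟨ψ, hψ⟩ (Subtype.ext (MvPowerSeries.ext fun e => ?_))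
  have hval : (polyGermHom n (X j - C c) : MvPowerSeries (Fin n) ℂ) =
      MvPowerSeries.X j - MvPowerSeries.C c := by
    rw [map_sub, AddSubgroupClass.coe_sub, coe_polyGermHom, coe_polyGermHom, coe_X, coe_C]
  change MvPowerSeries.coeff e ((polyGermHom n (X j - C c) : MvPowerSeries (Fin n) ℂ) * ψ) =
    MvPowerSeries.coeff e 1
  rw [hval, sub_mul, map_sub, MvPowerSeries.coeff_C_mul]
  rw [← pow_one (MvPowerSeries.X j), coeff_X_pow_mul', MvPowerSeries.coeff_one, hψc, hψc]
  by_cases he : e = Finsupp.single j (e j)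
  · obtain ⟨k, hk⟩ : ∃ k, e j = k := ⟨_, rfl⟩
    rw [hk] at he
    subst he
    cases k with
    | zero => simp [hc]
    | succ k =>
      simp only [Finsupp.single_eq_same]
      rw [if_pos (by omega), ← Finsupp.single_tsub, if_pos (by simp), if_pos trivial,
        if_neg (by simp)]
      simp
      field_simp
      ring
  · have he0 : e ≠ 0 := fun h => he (by simp [h])
    rw [if_neg he, if_neg he0, mul_zero, sub_zero]
    split_ifs with h1 h2
    · exfalso
      apply he
      have := congrArg (· + Finsupp.single j 1) h2
      simp only [tsub_add_cancel_of_le (Finsupp.single_le_iff.mpr h1)] at this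
      rw [this, ← Finsupp.single_add]
      simp
    · rfl
    · rfl

end Convergent

/-! ### Affine charts and homogenization. -/

section Dehomogenization

variable {n : ℕ} (i : Fin (n + 1)) (P : Fin n → ℂ)

/-- Restriction to the affine chart `x_i = 1`, with the origin moved to the point `P`. -/
def dehomogenize : MvPolynomial (Fin (n + 1)) ℂ →ₐ[ℂ] MvPolynomial (Fin n) ℂ :=
  aeval (i.insertNth (α := fun _ => MvPolynomial (Fin n) ℂ) 1 fun j => X j + C (P j))

theorem dehomogenize_C (c : ℂ) : dehomogenize i P (C c) = C c :=
  (dehomogenize i P).commutes c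

@[simp]
theorem dehomogenize_X_self : dehomogenize i P (X i) = 1 := by
  simp [dehomogenize]

@[simp]
theorem dehomogenize_X_succAbove (j : Fin n) :
    dehomogenize i P (X (i.succAbove j)) = X j + C (P j) := by
  simp [dehomogenize]

theorem dehomogenize_surjective : Function.Surjective (dehomogenize i P) := by
  have : (dehomogenize i P).comp
      (aeval fun j => X (i.succAbove j) - C (P j)) = AlgHom.id ℂ (MvPolynomial (Fin n) ℂ) := by
    ext j
    simp [← algebraMap_eq]
  exact fun s => ⟨_, DFunLike.congr_fun this s⟩

theorem eval_dehomogenize (y : Fin n → ℂ) (a : MvPolynomial (Fin (n + 1)) ℂ) :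
    eval y (dehomogenize i P a) =
      eval (i.insertNth (α := fun _ => ℂ) 1 fun j => y j + P j) a := by
  have : (aeval y).comp (dehomogenize i P) =
      (aeval (i.insertNth (α := fun _ => ℂ) 1 fun j => y j + P j) :
        MvPolynomial (Fin (n + 1)) ℂ →ₐ[ℂ] ℂ) := by
    ext k
    rcases Fin.eq_self_or_eq_succAbove i k with rfl | ⟨j, rfl⟩ <;> simp
  simpa [aeval_eq_eval] using DFunLike.congr_fun this a

/-- By homogeneity `a` vanishes wherever x_i ≠ 0, so x_i a vanishes everywhere. -/
theorem eq_zero_of_dehomogenize_eq_zero {a : MvPolynomial (Fin (n + 1)) ℂ} {d : ℕ}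
    (ha : a.IsHomogeneous d) (h : dehomogenize i P a = 0) : a = 0 := by
  have : X i * a = 0 := by
    refine MvPolynomial.funext fun v => ?_
    by_cases hv : v i = 0
    · simp [hv]
    · have h1 := eval_dehomogenize i P (fun j => v (i.succAbove j) / v i - P j) a
      have h2 : v = v i • (i.insertNth (α := fun _ => ℂ) 1
          fun j => v (i.succAbove j) / v i - P j + P j) := by
        funext k
        rcases Fin.eq_self_or_eq_succAbove i k with rfl | ⟨j, rfl⟩
        · simp
        · simp; field_simp
      rw [h, map_zero] at h1
      rw [map_mul, h2, eval_smul_of_isHomogeneous ha, ← h1]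
      simp
  exact (mul_eq_zero.mp this).resolve_left (X_ne_zero i)

theorem exists_homogenization (s : MvPolynomial (Fin (n + 1)) ℂ) {M : ℕ} (hM : s.totalDegree ≤ M) :
    ∃ s' : MvPolynomial (Fin (n + 1)) ℂ, s'.IsHomogeneous M ∧
      dehomogenize i P s' = dehomogenize i P s := by
  refine ⟨∑ t ∈ Finset.range (s.totalDegree + 1), homogeneousComponent t s * X i ^ (M - t), ?_, ?_⟩
  · refine IsHomogeneous.sum _ _ _ fun t ht => ?_
    have h1 := (homogeneousComponent_isHomogeneous t s).mul (isHomogeneous_X_pow (R := ℂ) i (M - t))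
    rwa [Nat.add_sub_cancel' (by rw [Finset.mem_range] at ht; omega)] at h1
  · conv_rhs => rw [← sum_homogeneousComponent s]
    simp only [map_sum, map_mul, map_pow, dehomogenize_X_self, one_pow, mul_one]

/-- Membership of a form in an ideal of forms can be tested in an affine chart, up to a power of the
coordinate that defines the chart. -/
theorem exists_X_pow_mul_mem {ι : Type*} [Finite ι] {φ : ι → MvPolynomial (Fin (n + 1)) ℂ} {d : ℕ}
    (hφ : ∀ k, (φ k).IsHomogeneous d) {a : MvPolynomial (Fin (n + 1)) ℂ} {e : ℕ}
    (ha : a.IsHomogeneous e)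
    (h : dehomogenize i P a ∈ Ideal.span (Set.range fun k => dehomogenize i P (φ k))) :
    ∃ M, X i ^ M * a ∈ Ideal.span (Set.range φ) := by
  have := Fintype.ofFinite ι
  obtain ⟨c, hc⟩ := Ideal.mem_span_range_iff_exists_fun.mp h
  choose s hs using fun k => dehomogenize_surjective i P (c k)
  -- A common degree for the homogenized coefficients; M ≥ e keeps the exponent M + d - e from
  -- truncating.
  let M := e + ∑ k, (s k).totalDegree
  have hM : ∀ k, (s k).totalDegree ≤ M := fun k =>
    (Finset.single_le_sum (f := fun k => (s k).totalDegree) (fun _ _ => Nat.zero_le _)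
      (Finset.mem_univ k)).trans (Nat.le_add_left _ _)
  choose s' hs' hss' using fun k => exists_homogenization i P (s k) (hM k)
  refine ⟨M + d - e, ?_⟩
  have hzero : X i ^ (M + d - e) * a - ∑ k, s' k * φ k = 0 := by
    refine eq_zero_of_dehomogenize_eq_zero i P (d := M + d) (IsHomogeneous.sub ?_ ?_) ?_
    · have h1 := (isHomogeneous_X_pow (R := ℂ) i (M + d - e)).mul ha
      rwa [Nat.sub_add_cancel (by omega)] at h1
    · exact IsHomogeneous.sum _ _ _ fun k _ => (hs' k).mul (hφ k)
    · simp only [map_sub, map_mul, map_pow, dehomogenize_X_self, one_pow, one_mul, map_sum, hss',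
        hs, hc, sub_self]
  rw [sub_eq_zero.mp hzero]
  exact Ideal.sum_mem _ fun k _ => Ideal.mul_mem_left _ _ (Ideal.subset_span ⟨k, rfl⟩)

theorem pderiv_dehomogenize (j : Fin n) (f : MvPolynomial (Fin (n + 1)) ℂ) :
    pderiv j (dehomogenize i P f) = dehomogenize i P (pderiv (i.succAbove j) f) := by
  classical
  induction f using MvPolynomial.induction_on with
  | C c => simp [← algebraMap_eq]
  | add p q hp hq => simp only [map_add, hp, hq]
  | mul_X p k hp =>
    have hk : pderiv j (dehomogenize i P (X k)) =
        dehomogenize i P (pderiv (i.succAbove j) (X k)) := by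
      rcases Fin.eq_self_or_eq_succAbove i k with rfl | ⟨l, rfl⟩
      · simp [pderiv_X_of_ne (Fin.succAbove_ne k j).symm]
      · simp [pderiv_X, Pi.single_apply, apply_ite]
    simp only [map_mul, Derivation.leibniz, smul_eq_mul, map_add, hp, hk]

/-- On the chart Euler's formula reads N f = f_{x_i} + ∑ (x_j + P_j) f_{x_j}. As N is invertible, f
and f_{x_i} are interchangeable generators. -/
theorem span_pderiv_dehomogenize {f : MvPolynomial (Fin (n + 1)) ℂ} {N : ℕ} (hN : N ≠ 0)
    (hf : f.IsHomogeneous N) :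
    Ideal.span (Set.range fun j => pderiv j (dehomogenize i P f)) ⊔
        Ideal.span {dehomogenize i P f} =
      Ideal.span (Set.range fun k => dehomogenize i P (pderiv k f)) := by
  have heuler := congrArg (dehomogenize i P) hf.sum_X_mul_pderiv
  rw [map_sum, Fin.sum_univ_succAbove _ i] at heuler
  simp only [map_mul, dehomogenize_X_self, one_mul, dehomogenize_X_succAbove, map_nsmul] at heuler
  apply le_antisymm
  · refine sup_le (Ideal.span_le.mpr ?_) (Ideal.span_le.mpr ?_)
    · rintro _ ⟨j, rfl⟩
      exact Ideal.subset_span ⟨i.succAbove j, (pderiv_dehomogenize i P j f).symm⟩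
    · rintro _ rfl
      have h1 : dehomogenize i P f = C ((N : ℂ)⁻¹) * (N • dehomogenize i P f) := by
        rw [← smul_eq_C_mul, ← Nat.cast_smul_eq_nsmul ℂ, smul_smul, inv_mul_cancel₀ (by simpa),
          one_smul]
      rw [SetLike.mem_coe, h1, ← heuler]
      exact Ideal.mul_mem_left _ _ (Ideal.add_mem _ (Ideal.subset_span ⟨i, rfl⟩)
        (Ideal.sum_mem _ fun j _ => Ideal.mul_mem_left _ _ (Ideal.subset_span ⟨_, rfl⟩)))
  · rw [Ideal.span_le]
    have hj : ∀ j, dehomogenize i P (pderiv (i.succAbove j) f) ∈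
        Ideal.span (Set.range fun j => pderiv j (dehomogenize i P f)) ⊔
          Ideal.span {dehomogenize i P f} := fun j =>
      Ideal.mem_sup_left (Ideal.subset_span ⟨j, pderiv_dehomogenize i P j f⟩)
    rintro _ ⟨k, rfl⟩
    rcases Fin.eq_self_or_eq_succAbove i k with rfl | ⟨j, rfl⟩
    · change dehomogenize k P (pderiv k f) ∈ _
      rw [eq_sub_of_add_eq heuler]
      exact Ideal.sub_mem _ (Submodule.smul_of_tower_mem _ N
        (Ideal.mem_sup_right (Ideal.mem_span_singleton_self _)))
        (Ideal.sum_mem _ fun j _ => Ideal.mul_mem_left _ _ (hj j))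
    · exact hj j

end Dehomogenization

/-! ### Local structure at an isolated zero. -/

section Local

variable {n : ℕ}

theorem eval_zero_ne_zero_of_isUnit {u : MvPolynomial (Fin n) ℂ} (hu : IsUnit (polyGermHom n u)) :
    eval 0 u ≠ 0 := by
  have h1 := (hu.map (convergentSeries n).val).map
    (MvPowerSeries.constantCoeff (σ := Fin n) (R := ℂ))
  intro h
  apply h1.ne_zero
  change MvPowerSeries.constantCoeff (polyGermHom n u : MvPowerSeries (Fin n) ℂ) = 0
  rw [coe_polyGermHom, ← MvPowerSeries.coeff_zero_eq_constantCoeff_apply, coeff_coe,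
    ← constantCoeff_eq, ← eval_zero]
  exact h

/-- If the common zeros of the `φ k` lie on finitely many lines, then locally at each of the
corresponding points of an affine chart, the `φ k` generate an ideal that contains a power of the
maximal ideal. -/
theorem exists_local_multiplier {ι κ : Type*} [Finite κ] {φ : ι → MvPolynomial (Fin (n + 1)) ℂ}
    {z : κ → Fin (n + 1) → ℂ} (hφ : ZerosOnLines φ z) (p : κ) (i : Fin (n + 1)) :
    ∃ (u : MvPolynomial (Fin n) ℂ) (b : ℕ), IsUnit (polyGermHom n u) ∧ ∀ j, u * X j ^ (b + 1) ∈
      Ideal.span (Set.range fun k =>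
        dehomogenize i (fun j => z p (i.succAbove j) / z p i) (φ k)) := by
  classical
  have := Fintype.ofFinite κ
  set P : Fin n → ℂ := fun j => z p (i.succAbove j) / z p i with hP
  -- The form `lam j q` vanishes on the line of `z q`, so a power of the product over `q` lies in
  -- (φ) by the Nullstellensatz. On the chart each factor becomes 1, X_j, or X_j minus a nonzero
  -- constant, which is a unit at the origin.
  let lam : Fin n → κ → MvPolynomial (Fin (n + 1)) ℂ := fun j q =>
    if z q i = 0 then X i else X (i.succAbove j) - C (z q (i.succAbove j) / z q i) * X i
  have hlam : ∀ j q (c : ℂ), eval (c • z q) (lam j q) = 0 := by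
    intro j q c
    by_cases hq : z q i = 0
    · simp [lam, hq]
    · simp only [lam, hq, if_false, map_sub, map_mul, eval_X, eval_C, Pi.smul_apply, smul_eq_mul]
      field_simp
      ring
  have hmem : ∀ j, ∃ M, (∏ q, lam j q) ^ M ∈ Ideal.span (Set.range φ) := by
    intro j
    rw [← Ideal.mem_radical_iff, ← vanishingIdeal_zeroLocus_eq_radical (K := ℂ)]
    intro v hv
    simp only [mem_zeroLocus_iff, aeval_eq_eval] at hv
    obtain ⟨q, c, rfl⟩ : ∃ (q : κ) (c : ℂ), v = c • z q := by
      rcases hφ v fun k => by simpa using hv _ (Ideal.subset_span ⟨k, rfl⟩) with h | h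
      · exact ⟨p, 0, by simp [h]⟩
      · exact h
    rw [map_prod]
    refine Finset.prod_eq_zero (Finset.mem_univ q) ?_
    simpa [aeval_eq_eval] using hlam j q c
  have hD : ∀ j q, ∃ (u : MvPolynomial (Fin n) ℂ) (b : ℕ), IsUnit (polyGermHom n u) ∧
      dehomogenize i P (lam j q) = u * X j ^ b := by
    intro j q
    by_cases hq : z q i = 0
    · exact ⟨1, 0, by simp, by simp [lam, hq]⟩
    · have h1 : dehomogenize i P (lam j q) = X j - C (z q (i.succAbove j) / z q i - P j) := by
        simp only [lam, hq, if_false, map_sub, map_mul, dehomogenize_X_succAbove,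
          dehomogenize_X_self, mul_one]
        rw [dehomogenize_C]
        ring
      by_cases hc : z q (i.succAbove j) / z q i - P j = 0
      · exact ⟨1, 1, by simp, by rw [h1, hc]; simp⟩
      · exact ⟨_, 0, isUnit_polyGermHom_X_sub_C j hc, by rw [h1]; simp⟩
  choose M hM using hmem
  choose u b hu hub using hD
  set I := Ideal.span (Set.range fun k => dehomogenize i P (φ k)) with hI
  have hmap : ∀ x ∈ Ideal.span (Set.range φ), dehomogenize i P x ∈ I := by
    intro x hx
    have := Ideal.mem_map_of_mem (dehomogenize i P) hx
    rwa [Ideal.map_span, ← Set.range_comp] at this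
  have hj : ∀ j, (∏ q, u j q) ^ M j * X j ^ ((∑ q, b j q) * M j) ∈ I := by
    intro j
    have := hmap _ (hM j)
    rw [map_pow, map_prod] at this
    simp only [hub, Finset.prod_mul_distrib, Finset.prod_pow_eq_pow_sum, mul_pow, ← pow_mul] at this
    exact this
  refine ⟨∏ j, (∏ q, u j q) ^ M j, ∑ j, (∑ q, b j q) * M j, ?_, fun j => ?_⟩
  · rw [map_prod]
    refine IsUnit.prod_univ_iff.mpr fun j => ?_
    rw [map_pow, map_prod]
    exact (IsUnit.prod_univ_iff.mpr fun q => hu j q).pow _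
  · have hle : (∑ q, b j q) * M j ≤ (∑ j, (∑ q, b j q) * M j) + 1 :=
      (Finset.single_le_sum (f := fun j => (∑ q, b j q) * M j) (fun _ _ => Nat.zero_le _)
        (Finset.mem_univ j)).trans (Nat.le_succ _)
    exact I.mem_of_dvd (mul_dvd_mul (Finset.dvd_prod_of_mem (fun j => (∏ q, u j q) ^ M j)
      (Finset.mem_univ j)) (pow_dvd_pow _ hle)) (hj j)

end Local

/-! ### The singular scheme and its functions. -/

section Singularities

variable {n N : ℕ} {f : MvPolynomial (Fin (n + 1)) ℂ}

theorem localEquation_eq (f : MvPolynomial (Fin (n + 1)) ℂ) (p : ℙ ℂ (Fin (n + 1) → ℂ)) :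
    localEquation f p = dehomogenize (chartIndex p) (affineCoord p) f := rfl

theorem zerosOnLines_pderiv (hN : N ≠ 0) (hf : f.IsHomogeneous N) :
    ZerosOnLines (fun k => pderiv k f) fun q : singularLocus f => q.1.rep := by
  intro v hv
  by_cases hv0 : v = 0
  · exact Or.inl hv0
  right
  obtain ⟨c, hc⟩ := Projectivization.exists_smul_eq_mk_rep ℂ v hv0
  rw [Units.smul_def] at hc
  have hfv : eval v f = 0 := by
    have := congrArg (eval v) hf.sum_X_mul_pderiv
    rw [map_sum, map_nsmul, Finset.sum_eq_zero fun k _ => by rw [map_mul, hv k, mul_zero]] at this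
    simpa [hN] using this.symm
  refine ⟨⟨Projectivization.mk ℂ v hv0, ?_, fun k => ?_⟩, (c : ℂ)⁻¹, ?_⟩
  · rw [← hc, eval_smul_of_isHomogeneous hf, hfv, mul_zero]
  · rw [← hc, eval_smul_of_isHomogeneous hf.pderiv, hv k, mul_zero]
  · change v = (c : ℂ)⁻¹ • (Projectivization.mk ℂ v hv0).rep
    rw [← hc, smul_smul, inv_mul_cancel₀ c.ne_zero, one_smul]

/-- The ideal of the affine chart `x_i = 1` of the singular scheme, for a chart around `p`. -/
def chartJacobianIdeal (f : MvPolynomial (Fin (n + 1)) ℂ) (p : ℙ ℂ (Fin (n + 1) → ℂ)) :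
    Ideal (MvPolynomial (Fin n) ℂ) :=
  Ideal.span (Set.range fun k => dehomogenize (chartIndex p) (affineCoord p) (pderiv k f))

theorem tjurinaIdeal_eq (hN : N ≠ 0) (hf : f.IsHomogeneous N) (p : ℙ ℂ (Fin (n + 1) → ℂ)) :
    localJacobianIdeal (localEquation f p) ⊔ Ideal.span {polyGerm (localEquation f p)} =
      (chartJacobianIdeal f p).map (polyGermHom n) := by
  rw [chartJacobianIdeal, ← span_pderiv_dehomogenize _ _ hN hf, ← localEquation_eq, Ideal.map_sup,
    Ideal.map_span, Ideal.map_span, Set.image_singleton, ← Set.range_comp, polyGermHom_apply]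
  congr 3

theorem exists_chart_multiplier (hN : N ≠ 0) (hf : f.IsHomogeneous N)
    (hV : HasOnlyIsolatedSingularities f) {p : ℙ ℂ (Fin (n + 1) → ℂ)} (hp : p ∈ singularLocus f) :
    ∃ (u : MvPolynomial (Fin n) ℂ) (b : ℕ), IsUnit (polyGermHom n u) ∧
      ∀ j, u * X j ^ (b + 1) ∈ chartJacobianIdeal f p := by
  have : Finite (singularLocus f) := hV
  exact exists_local_multiplier (zerosOnLines_pderiv hN hf) ⟨p, hp⟩ (chartIndex p)

/-- `finrank` is zero by default on infinite-dimensional spaces; finiteness makes the Tjurina number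
a true dimension. -/
theorem finite_tjurinaAlgebra (hN : N ≠ 0) (hf : f.IsHomogeneous N)
    (hV : HasOnlyIsolatedSingularities f) {p : ℙ ℂ (Fin (n + 1) → ℂ)} (hp : p ∈ singularLocus f) :
    Module.Finite ℂ (TjurinaAlgebra (localEquation f p)) := by
  obtain ⟨u, b, hu, hub⟩ := exists_chart_multiplier hN hf hV hp
  unfold TjurinaAlgebra
  rw [tjurinaIdeal_eq hN hf]
  exact finite_quotient_map hub hu

/-- The functions on the singular scheme. -/
def SingularSections (f : MvPolynomial (Fin (n + 1)) ℂ) : Type :=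
  (p : singularLocus f) → TjurinaAlgebra (localEquation f p.1)

instance : AddCommGroup (SingularSections f) :=
  inferInstanceAs (AddCommGroup ((p : singularLocus f) → TjurinaAlgebra (localEquation f p.1)))

instance : Module ℂ (SingularSections f) :=
  inferInstanceAs (Module ℂ ((p : singularLocus f) → TjurinaAlgebra (localEquation f p.1)))

/-- The restriction of a form to the singular scheme. -/
def restrictToSingular (f : MvPolynomial (Fin (n + 1)) ℂ) :
    MvPolynomial (Fin (n + 1)) ℂ →ₗ[ℂ] SingularSections f :=
  LinearMap.pi fun p => (((Ideal.Quotient.mkₐ ℂ _).comp (polyGermHom n)).comp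
    (dehomogenize (chartIndex p.1) (affineCoord p.1))).toLinearMap

theorem finite_and_finrank_pi {ι : Type*} [Finite ι] (M : ι → Type) [∀ i, AddCommGroup (M i)]
    [∀ i, Module ℂ (M i)] (h : ∀ i, Module.Finite ℂ (M i)) :
    Module.Finite ℂ (∀ i, M i) ∧ Module.finrank ℂ (∀ i, M i) = ∑ᶠ i, Module.finrank ℂ (M i) := by
  have := Fintype.ofFinite ι
  exact ⟨inferInstance, by rw [Module.finrank_pi_fintype, finsum_eq_sum_of_fintype]⟩

theorem finrank_singularSections (hN : N ≠ 0) (hf : f.IsHomogeneous N)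
    (hV : HasOnlyIsolatedSingularities f) :
    Module.Finite ℂ (SingularSections f) ∧
      Module.finrank ℂ (SingularSections f) = tjurinaNumber f := by
  have : Finite (singularLocus f) := hV
  rw [tjurinaNumber, ← finsum_set_coe_eq_finsum_mem]
  exact finite_and_finrank_pi (fun p : singularLocus f => TjurinaAlgebra (localEquation f p.1))
    fun p => finite_tjurinaAlgebra hN hf hV p.2

/-- A form that vanishes on the singular scheme is multiplied into the Jacobian ideal by a form that
does not vanish at a given singularity. -/
theorem exists_eval_ne_zero_mul_mem (hN : N ≠ 0) (hf : f.IsHomogeneous N)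
    (hV : HasOnlyIsolatedSingularities f) {a : MvPolynomial (Fin (n + 1)) ℂ} {e : ℕ}
    (ha : a.IsHomogeneous e) (h : restrictToSingular f a = 0)
    {p : ℙ ℂ (Fin (n + 1) → ℂ)} (hp : p ∈ singularLocus f) :
    ∃ w M, w.IsHomogeneous M ∧ eval p.rep w ≠ 0 ∧
      w * a ∈ Ideal.span (Set.range fun k => pderiv k f) := by
  obtain ⟨u, b, hu, hub⟩ := exists_chart_multiplier hN hf hV hp
  have h1 : polyGermHom n (dehomogenize (chartIndex p) (affineCoord p) a) ∈
      (chartJacobianIdeal f p).map (polyGermHom n) := by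
    rw [← tjurinaIdeal_eq hN hf, ← Ideal.Quotient.eq_zero_iff_mem]
    exact congrFun h ⟨p, hp⟩
  have h2 := mul_mem_of_germ_mem hub h1
  obtain ⟨s, hs⟩ := dehomogenize_surjective (chartIndex p) (affineCoord p) u
  obtain ⟨U, hU, hUs⟩ := exists_homogenization (chartIndex p) (affineCoord p) s le_rfl
  rw [← hs, ← hUs, ← map_mul] at h2
  obtain ⟨M, hM⟩ := exists_X_pow_mul_mem _ _ (fun k => hf.pderiv) (hU.mul ha) h2
  -- `U` homogenizes a lift of `u`, and u(0) ≠ 0, so neither factor vanishes at `p`.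
  refine ⟨X (chartIndex p) ^ M * U, _, (isHomogeneous_X_pow _ _).mul hU, ?_, by rwa [mul_assoc]⟩
  have hpi : p.rep (chartIndex p) ≠ 0 := Classical.choose_spec (exists_rep_ne_zero p)
  have h3 := eval_dehomogenize (chartIndex p) (affineCoord p) 0 U
  have h4 : p.rep = p.rep (chartIndex p) • ((chartIndex p).insertNth (α := fun _ => ℂ) 1
      fun j => (0 : Fin n → ℂ) j + affineCoord p j) := by
    funext k
    rcases Fin.eq_self_or_eq_succAbove (chartIndex p) k with hk | ⟨j, hk⟩
    · rw [hk]; simp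
    · rw [hk]; simp [affineCoord]; field_simp
  rw [map_mul, map_pow, eval_X]
  refine mul_ne_zero (pow_ne_zero _ hpi) ?_
  rw [h4, eval_smul_of_isHomogeneous hU, ← h3, hUs, hs]
  exact mul_ne_zero (pow_ne_zero _ hpi) (eval_zero_ne_zero_of_isUnit hu)

/-- At a zero of (J : a) the partials vanish, so it lies on a line over a singular point; there some
form in (J : a) is nonzero, which leaves only the origin. The Nullstellensatz puts ℓ in the radical.
-/
theorem exists_linear_pow_mul_mem (hN : N ≠ 0) (hf : f.IsHomogeneous N)
    (hV : HasOnlyIsolatedSingularities f) {a : MvPolynomial (Fin (n + 1)) ℂ} {e : ℕ}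
    (ha : a.IsHomogeneous e) (h : restrictToSingular f a = 0)
    {ℓ : MvPolynomial (Fin (n + 1)) ℂ} (hℓ : ℓ.IsHomogeneous 1) :
    ∃ M, ℓ ^ M * a ∈ Ideal.span (Set.range fun k => pderiv k f) := by
  suffices hrad : ℓ ∈ ((Ideal.span (Set.range fun k => pderiv k f)).colon {a}).radical by
    obtain ⟨M, hM⟩ := hrad
    exact ⟨M, Submodule.mem_colon_singleton.mp hM⟩
  rw [← vanishingIdeal_zeroLocus_eq_radical (K := ℂ)]
  intro v hv
  simp only [mem_zeroLocus_iff, aeval_eq_eval] at hv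
  have h1 : ∀ w, w * a ∈ Ideal.span (Set.range fun k => pderiv k f) → eval v w = 0 := fun w hw => by
    simpa using hv w (Submodule.mem_colon_singleton.mpr hw)
  rcases zerosOnLines_pderiv hN hf v fun k =>
    h1 _ (Ideal.mul_mem_right _ _ (Ideal.subset_span ⟨k, rfl⟩)) with h0 | ⟨p, c, hc⟩
  · have := eval_smul_of_isHomogeneous hℓ 0 v
    rw [h0] at this ⊢
    simpa [aeval_eq_eval] using this
  · obtain ⟨w, M, hw, hwp, hwa⟩ := exists_eval_ne_zero_mul_mem hN hf hV ha h p.2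
    have h2 := h1 w hwa
    rw [hc, eval_smul_of_isHomogeneous hw, mul_eq_zero, or_iff_left hwp] at h2
    have hc0 : c = 0 := eq_zero_of_pow_eq_zero h2
    have := eval_smul_of_isHomogeneous hℓ c p.1.rep
    rw [← hc, hc0, pow_one, zero_mul] at this
    simpa [aeval_eq_eval] using this

end Singularities

/-! ### Forms independent on the singular scheme. -/

section Independence

variable {σ K : Type*} [Field K]

/-- If the socle modulo `I + (ℓ)` lives in degree `D`, then a form `b ∉ I + (ℓ)` of degree `m ≤ D`
has multiples in all degrees up to `D` outside `I + (ℓ)`. -/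
theorem exists_multiple_not_mem {Q : Ideal (MvPolynomial σ K)} {D : ℕ}
    (hsoc : ∀ (e : ℕ) (s : MvPolynomial σ K), s.IsHomogeneous e → s ∉ Q → (∀ i, X i * s ∈ Q) →
      e = D) {b : MvPolynomial σ K} {m : ℕ} (hb : b.IsHomogeneous m) (hbQ : b ∉ Q) (k : ℕ)
    (hk : m + k ≤ D) : ∃ h : MvPolynomial σ K, h.IsHomogeneous k ∧ b * h ∉ Q := by
  induction k with
  | zero => exact ⟨1, isHomogeneous_one _ _, by simpa using hbQ⟩
  | succ k ih =>
    obtain ⟨h, hh, hbh⟩ := ih (by omega)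
    have : ¬ ∀ i, X i * (b * h) ∈ Q := fun hall => by
      have := hsoc _ _ (hb.mul hh) hbh hall
      omega
    obtain ⟨i, hi⟩ := not_forall.mp this
    exact ⟨h * X i, hh.mul (isHomogeneous_X K i), by rwa [← mul_assoc, mul_comm _ (X i)]⟩

/-- Let k be the largest index with c_k ≠ 0. All other nonzero terms are divisible by ℓ^(t-k+1);
cancelling ℓ^(t-k) gives c_k b h_k ∈ I + (ℓ), a contradiction. -/
theorem eq_zero_of_sum_mem {I : Ideal (MvPolynomial σ K)} {ℓ b : MvPolynomial σ K}
    (hnz : NzdMod I ℓ) {t : ℕ} {h : Fin (t + 1) → MvPolynomial σ K}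
    (hh : ∀ k, b * h k ∉ I ⊔ Ideal.span {ℓ}) {c : Fin (t + 1) → K}
    (hc : b * ∑ k, c k • (ℓ ^ (t - k.1) * h k) ∈ I) : c = 0 := by
  classical
  by_contra hne
  obtain ⟨k0, hk0⟩ := Function.ne_iff.mp hne
  let A : Finset (Fin (t + 1)) := Finset.univ.filter fun k => c k ≠ 0
  have hA : A.Nonempty := ⟨k0, by simpa [A] using hk0⟩
  set k := A.max' hA with hk
  have hck : c k ≠ 0 := by simpa [A] using A.max'_mem hA
  have hdvd : ℓ ^ (t - k.1) * ℓ ∣ ∑ j ∈ Finset.univ.erase k, c j • (ℓ ^ (t - j.1) * h j) := by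
    refine Finset.dvd_sum fun j hj => ?_
    by_cases hcj : c j = 0
    · simp [hcj]
    · have hjk : j ≤ k := A.le_max' j (by simpa [A] using hcj)
      have hlt : j < k := lt_of_le_of_ne hjk (Finset.ne_of_mem_erase hj)
      have h1 : j.1 < k.1 := hlt
      have h2 := k.2
      rw [← pow_succ, smul_eq_C_mul]
      exact ((pow_dvd_pow ℓ (by omega)).mul_right _).mul_left _
  obtain ⟨w, hw⟩ := hdvd
  rw [← Finset.add_sum_erase _ _ (Finset.mem_univ k), hw] at hc
  have h3 : ℓ ^ (t - k.1) * (C (c k) * (b * h k) + ℓ * (b * w)) ∈ I := by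
    rw [smul_eq_C_mul] at hc
    convert hc using 1
    ring
  have h4 := hnz.pow _ _ h3
  have h5 : C (c k) * (b * h k) ∈ I ⊔ Ideal.span {ℓ} :=
    mem_sup_span_singleton.mpr ⟨-(b * w), by convert h4 using 1; ring⟩
  apply hh k
  have h6 := Ideal.mul_mem_left _ (C (c k)⁻¹) h5
  rwa [← mul_assoc, ← C_mul, inv_mul_cancel₀ hck, C_1, one_mul] at h6

end Independence

/-! ### The degree bound and the reduction to a complete intersection. -/

section Main

variable {n N : ℕ} {f : MvPolynomial (Fin (n + 1)) ℂ}

theorem mem_KR_of_isKoszulRelation {a : AR f}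
    (ha : IsKoszulRelation (fun k => pderiv k f) a.1) : a ∈ KR f := by
  classical
  obtain ⟨B, hB, hBa⟩ := ha
  have hij : ∀ i j, B j i = -B i j := fun i j => congrFun (congrFun hB i) j
  -- The sum runs over ordered pairs and counts each Koszul relation twice, whence the factor 1/2.
  have key : a = ∑ ij : Fin (n + 1) × Fin (n + 1), (C (2⁻¹ : ℂ) * B ij.1 ij.2) •
      (⟨koszulRelation f ij.1 ij.2, koszulRelation_mem f ij.1 ij.2⟩ : AR f) := by
    refine Subtype.ext (funext fun k => ?_)
    rw [Fintype.sum_prod_type, Submodule.coe_sum, Finset.sum_apply]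
    simp only [Submodule.coe_sum, Finset.sum_apply, Submodule.coe_smul, Pi.smul_apply,
      koszulRelation, Pi.sub_apply, smul_eq_mul, mul_sub, Finset.sum_sub_distrib, Pi.single_apply,
      mul_ite, mul_zero, Finset.sum_ite_irrel, Finset.sum_const_zero, Finset.sum_ite_eq,
      Finset.mem_univ, if_true]
    rw [hBa, ← Finset.sum_sub_distrib, Matrix.mulVec, dotProduct]
    refine Finset.sum_congr rfl fun j _ => ?_
    rw [hij k j]
    have h2 : (C (2⁻¹ : ℂ) : MvPolynomial (Fin (n + 1)) ℂ) * 2 = 1 := by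
      rw [← map_ofNat (C : ℂ →+* MvPolynomial (Fin (n + 1)) ℂ) 2, ← C_mul]; simp
    linear_combination (-(B k j * pderiv j f)) * h2
  rw [key]
  exact Submodule.sum_mem _ fun ij _ => Submodule.smul_mem _ _ (Submodule.subset_span ⟨ij, rfl⟩)

/-- A form of low degree that multiplies the Jacobian ideal into a complete intersection of codimension
`n` contained in it lies in this complete intersection. -/
theorem mem_of_pderiv_mul_mem (hf : f.IsHomogeneous N) {d : ℕ} (hd : 0 < d) (hNd : N = d + 1)
    (hV : HasOnlyIsolatedSingularities f) {θs : List (MvPolynomial (Fin (n + 1)) ℂ)}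
    (hlen : θs.length = n) (hθ : ∀ θ ∈ θs, θ.IsHomogeneous d) (hreg : IsRegularMod ⊥ θs)
    {m : ℕ} (hm : m + tjurinaNumber f ≤ n * (d - 1)) {s : MvPolynomial (Fin (n + 1)) ℂ}
    (hs : s.IsHomogeneous m) (hsJ : ∀ k, pderiv k f * s ∈ Ideal.ofList θs) :
    s ∈ Ideal.ofList θs := by
  by_contra hsI
  have hN : N ≠ 0 := by omega
  have hI : IsHomogeneousIdeal (Ideal.ofList θs) := isHomogeneousIdeal_ofList fun θ h => ⟨d, hθ θ h⟩
  obtain ⟨ℓ, hℓ, hℓnz, -⟩ := exists_linear_nzdMod (κ := Empty) (z := fun i => i.elim)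
    (mem_of_linear_mul_mem hd hθ hreg (by simp [hlen])) (fun i => i.elim)
  obtain ⟨e, b, he, hb, hbI, hbs⟩ := exists_not_mem_sup hI hℓ hℓnz hs hsI
  have hbJ : ∀ x ∈ Ideal.span (Set.range fun k => pderiv k f), x * b ∈ Ideal.ofList θs := by
    intro x hx
    have hle : Ideal.span (Set.range fun k => pderiv k f) ≤ (Ideal.ofList θs).colon {b} :=
      Ideal.span_le.mpr (by
        rintro _ ⟨k, rfl⟩
        exact Submodule.mem_colon_singleton.mpr (hbs _ (hsJ k)))
    exact Submodule.mem_colon_singleton.mp (hle hx)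
  have hregℓ : IsRegularMod (Ideal.ofList [ℓ]) θs := by
    have := (IsRegularMod.sup (I := ⊥)
      (by rw [← Ideal.ofList_nil]; exact isHomogeneousIdeal_ofList (by simp))
      (fun a ha => ⟨d, hd, hθ a ha⟩) hℓ hreg (by rwa [bot_sup_eq])).2
    rwa [bot_sup_eq, ← Ideal.ofList_singleton] at this
  have hsoc : ∀ (e : ℕ) (s : MvPolynomial (Fin (n + 1)) ℂ), s.IsHomogeneous e →
      s ∉ Ideal.ofList θs ⊔ Ideal.span {ℓ} → (∀ i, X i * s ∈ Ideal.ofList θs ⊔ Ideal.span {ℓ}) →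
      e = n * (d - 1) := by
    intro e s hs hsQ hX
    rw [sup_comm, ← Ideal.ofList_singleton] at hsQ hX
    have := (socle_degree hd θs hθ [ℓ] (by simpa using hℓ) hregℓ hs hsQ hX).2
    rw [hlen] at this
    obtain ⟨d', rfl⟩ := Nat.exists_eq_add_of_lt hd
    have h1 : 0 + d' + 1 - 1 = d' := by omega
    rw [h1]
    linarith
  obtain ⟨t, ht⟩ : ∃ t, e + t = n * (d - 1) := ⟨n * (d - 1) - e, by omega⟩
  choose h hh hbh using fun k : Fin (t + 1) =>
    exists_multiple_not_mem hsoc hb hbI k.1 (by have := k.2; omega)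
  obtain ⟨hfin, hrank⟩ := finrank_singularSections hN hf hV
  have hli : LinearIndependent ℂ fun k : Fin (t + 1) =>
      restrictToSingular f (ℓ ^ (t - k.1) * h k) := by
    rw [Fintype.linearIndependent_iff]
    intro c hc
    simp only [← map_smul, ← map_sum] at hc
    have hhom : (∑ k, c k • (ℓ ^ (t - k.1) * h k)).IsHomogeneous t :=
      IsHomogeneous.sum _ _ _ fun k _ => by
        rw [smul_eq_C_mul]
        refine IsHomogeneous.C_mul ?_ _
        have h1 := (hℓ.pow (t - k.1)).mul (hh k)
        rwa [one_mul, Nat.sub_add_cancel (by have := k.2; omega)] at h1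
    obtain ⟨M, hM⟩ := exists_linear_pow_mul_mem hN hf hV hhom hc hℓ
    have h1 := hbJ _ hM
    rw [mul_assoc, mul_comm _ b] at h1
    exact congrFun (eq_zero_of_sum_mem hℓnz hbh (hℓnz.pow M _ h1))
  -- This gives t + 1 ≤ τ(V), whereas e ≤ m gives t ≥ τ(V).
  have := hli.fintype_card_le_finrank
  rw [Fintype.card_fin, hrank] at this
  omega

theorem isKoszulRelation_of_low_degree (hf : f.IsHomogeneous N) {d : ℕ} (hd : 0 < d)
    (hNd : N = d + 1) (hV : HasOnlyIsolatedSingularities f)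
    {m : ℕ} (hm : m + tjurinaNumber f ≤ n * (d - 1)) {a : Fin (n + 1) → MvPolynomial (Fin (n + 1)) ℂ}
    (ha : ∀ j, (a j).IsHomogeneous m) (hrel : ∑ j, a j * pderiv j f = 0) :
    IsKoszulRelation (fun k => pderiv k f) a := by
  have hφ : ∀ k, (pderiv k f).IsHomogeneous d := fun k => by
    have := hf.pderiv (i := k)
    rwa [hNd, Nat.add_sub_cancel] at this
  have : Finite (singularLocus f) := hV
  obtain ⟨c, hc, hreg⟩ := exists_regular_combinations (z := fun q : singularLocus f => q.1.rep)
    (fun q => q.1.rep_nonzero) (zerosOnLines_pderiv (by omega) hf) hd hφ n (by simp)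
  -- Independence of the coefficient vectors suffices here; the partials themselves may be linearly
  -- dependent.
  obtain ⟨c0, hc0⟩ := exists_linearIndependent_cons_of_lt_finrank hc (by simp)
  obtain ⟨E, hE⟩ : ∃ E : Matrix (Fin (n + 1)) (Fin (n + 1)) ℂ, E * Matrix.of (Fin.cons c0 c) = 1 := by
    have h1 : IsUnit (Matrix.of (Fin.cons c0 c : Fin (n + 1) → Fin (n + 1) → ℂ)) :=
      Matrix.linearIndependent_rows_iff_isUnit.mp hc0
    exact h1.exists_left_inv
  set C' : Matrix (Fin (n + 1)) (Fin (n + 1)) ℂ := Matrix.of (Fin.cons c0 c) with hC'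
  set φ : Fin (n + 1) → MvPolynomial (Fin (n + 1)) ℂ := fun k => pderiv k f with hφdef
  have hEC : E.map C * C'.map C = (1 : Matrix _ _ (MvPolynomial (Fin (n + 1)) ℂ)) := by
    rw [← Matrix.map_mul, hE]
    exact Matrix.map_one C C_0 C_1
  set g := (C'.map C).mulVec φ with hg
  set a' := (E.map C).transpose.mulVec a with ha'
  have htail : Fin.tail g = fun j => Fintype.linearCombination ℂ φ (c j) := by
    funext j
    simp [hg, hC', Fin.tail, Matrix.mulVec, dotProduct, Fintype.linearCombination_apply,
      smul_eq_C_mul]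
  refine IsKoszulRelation.of_change hEC ?_
  have hφg : φ = (E.map C).mulVec g := by
    rw [hg, Matrix.mulVec_mulVec, hEC, Matrix.one_mulVec]
  have hrel' : ∑ j, a' j * g j = 0 := by
    change a' ⬝ᵥ g = 0
    rw [ha', Matrix.mulVec_transpose, ← Matrix.dotProduct_mulVec, ← hφg]
    exact hrel
  rw [← htail] at hreg
  refine isKoszulRelation_of_tail (isKoszulRelation_of_isRegularMod hreg) hrel' ?_
  have ha'0 : (a' 0).IsHomogeneous m := IsHomogeneous.sum _ _ _ fun j _ => by
    simpa using (ha j).C_mul (E j 0)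
  have hgmem : ∀ j : Fin n, g j.succ ∈ Ideal.ofList (List.ofFn (Fin.tail g)) := fun j =>
    Ideal.subset_span (List.mem_ofFn.mpr ⟨j, rfl⟩)
  -- The relation puts g_0 a'_0 in (g_1, …, g_n). Since the partials are combinations of the g_j,
  -- all of them multiply a'_0 into this ideal.
  have hg0 : g 0 * a' 0 ∈ Ideal.ofList (List.ofFn (Fin.tail g)) := by
    rw [Fin.sum_univ_succ, ← eq_neg_iff_add_eq_zero] at hrel'
    rw [mul_comm, hrel']
    exact neg_mem (Ideal.sum_mem _ fun j _ => Ideal.mul_mem_left _ _ (hgmem j))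
  refine mem_of_pderiv_mul_mem hf hd hNd hV (by simp) ?_ hreg hm ha'0 fun k => ?_
  · intro θ hθ
    obtain ⟨j, rfl⟩ := List.mem_ofFn.mp hθ
    rw [htail]
    exact (homogeneousSubmodule _ ℂ d).sum_mem fun i _ =>
      (homogeneousSubmodule _ ℂ d).smul_mem _ (hφ i)
  · change φ k * a' 0 ∈ _
    rw [hφg, Matrix.mulVec, dotProduct, Finset.sum_mul, Fin.sum_univ_succ]
    refine Ideal.add_mem _ ?_ (Ideal.sum_mem _ fun j _ => ?_)
    · rw [mul_assoc]
      exact Ideal.mul_mem_left _ _ hg0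
    · exact Ideal.mul_mem_right _ _ (Ideal.mul_mem_left _ _ (hgmem j))

end Main

end JacobianSyzygies

end

theorem theorem1p1 (n N : ℕ) (hN : 1 < N) (f : MvPolynomial (Fin (n + 1)) ℂ)
    (hf0 : f ≠ 0) (hf : f.IsHomogeneous N)
    (hV : JacobianSyzygies.HasOnlyIsolatedSingularities f)
    (m : ℕ) (hm : (m : ℤ) ≤ n * ((N : ℤ) - 2) - JacobianSyzygies.tjurinaNumber f) :
    JacobianSyzygies.ERDegree f m = ⊥ := by
  obtain ⟨d, rfl⟩ : ∃ d, N = d + 1 + 1 := ⟨N - 2, by omega⟩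
  have hm' : m + JacobianSyzygies.tjurinaNumber f ≤ n * (d + 1 - 1) := by
    rw [Nat.add_sub_cancel]
    zify
    push_cast at hm
    linarith
  rw [eq_bot_iff]
  rintro _ ⟨a, ha, rfl⟩
  exact (Submodule.Quotient.mk_eq_zero _).mpr (JacobianSyzygies.mem_KR_of_isKoszulRelation
    (JacobianSyzygies.isKoszulRelation_of_low_degree hf d.succ_pos rfl hV hm' ha a.2))
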